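/- **Setting.** Let $\Omega\subset\mathbb R^2$ be a bounded domain with Lipschitz boundary, $\partial\Omega=\overline{\Gamma_D}\cup\overline{\Gamma_N}$ with $\Gamma_D\cap\Gamma_N=\emptyset$, where $\Gamma_D$ is relatively open in $\partial\Omega$ and $\mathcal H^1(\Gamma_D)>0$. Let $p>2$, $p'=\frac p{p-1}$, $\tilde p=\frac{3p}{p+1}$, $\alpha\ge\frac{3p}{p-2}$, and put $$\mathcal U^{q}=\{u\in W^{1,q}(\Omega;\mathbb R^2): u|_{\Gamma_D}=0\},\quad \mathcal U=\mathcal U^2,\quad \mathcal Z=H^1(\Omega),\quad \mathcal V=L^\alpha(\Omega).$$ Let $T,\kappa,\eta>0$, let $\ell\in C^{1,1}([0,T];(\mathcal U^{p'})^*)$, and let $\mathbf C\in L^\infty(\Omega;\mathrm{Lin}(\mathbb R^{2\times2}_{\rm sym},\mathbb R^{2\times2}_{\rm sym}))$ satisfy, for some $\gamma>0$, $(\mathbf C(x)\xi):\xi\ge\gamma|\xi|^2$ and $(\mathbf C(x)\xi_1):\xi_2=(\mathbf C(x)\xi_2):\xi_1$ for all symmetric $\xi,\xi_1,\xi_2$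 and a.a. $x\in\Omega$. With $\varepsilon(u)=\frac12(\nabla u+(\nabla u)^{\sf T})$ and $\|z\|_{\mathcal Z}^2=\|z\|_{L^2}^2+\|\nabla z\|_{L^2}^2$ let $$\mathcal E(t,u,z)=\frac\kappa2\|z\|_{\mathcal Z}^2+\frac12\int_\Omega(z^2+\eta)\,\mathbf C\varepsilon(u):\varepsilon(u)\,dx-\langle\ell(t),u\rangle,$$ $$\mathcal R(v)=\begin{cases}\int_\Omega\kappa|v|\,dx,& v\le0\text{ a.e. in }\Omega,\\ \infty,&\text{otherwise.}\end{cases}$$ Here $\mathrm D_z\mathcal E(t,u,z)\in\mathcal Z^*$ is the Fréchet derivative of $\mathcal E(t,u,\cdot)$ on $\mathcal Z$ (for $u\in\mathcal U^{\tilde p}$), and for $w\in\mathcal U$ $$\langle\mathrm D_u\mathcal E(t,u,z),w\rangle=\int_\Omega(z^2+\eta)\,\mathbf C\varepsilon(u):\varepsilon(w)\,dx-\langle\ell(t),w\rangle .$$ Let $\partial^{\mathcal Z}\mathcal R(0)\subset\mathcal Z^*$ be the subdifferential of $\mathcal R|_{\mathcal Z}$ at $0$. For $\zeta\in\mathcal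 Z^*$ let $$\operatorname{dist}_{\mathcal V^*}(\zeta,\partial^{\mathcal Z}\mathcal R(0))=\inf\{\|\zeta-\sigma\|_{\mathcal V^*}:\sigma\in\partial^{\mathcal Z}\mathcal R(0),\ \zeta-\sigma\in\mathcal V^*\}\in[0,\infty],\qquad \inf\emptyset=\infty .$$ The convention $0\cdot\infty=0$ is used. For a triple $(\hat t,\hat u,\hat z)$ abbreviate $$d(s)=\operatorname{dist}_{\mathcal V^*}\bigl(-\mathrm D_z\mathcal E(\hat t(s),\hat u(s),\hat z(s)),\partial^{\mathcal Z}\mathcal R(0)\bigr).$$ **Lemma.** Let $S>0$, $z_0\in\mathcal Z$ with $0\le z_0\le1$ a.e. in $\Omega$, and let $$\hat t\in W^{1,\infty}((0,S);\mathbb R),\quad \hat u\in W^{1,\infty}((0,S);\mathcal U^{\tilde p}),\quad \hat z\in W^{1,\infty}((0,S);\mathcal V)\cap H^1((0,S);\mathcal Z)$$ (continuous representatives) satisfy 1. the initial (and end point) conditions $\hat t(0)=0$, $\hat t(S)=T$, $\hat u(0)=\operatorname{argmin}\{\mathcal E(0,u,z_0):u\in\mathcal U\}$, $\hat z(0)=z_0$;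 2. the complementarity relations: for a.a. $s\in[0,S]$, $\ \hat t'(s)\ge0$, $\ \hat t'(s)+\|\hat z'(s)\|_{\mathcal V}\le1$, $\ \hat t'(s)\,d(s)=0$; 3. the balance of linear momentum: for a.a. $s\in[0,S]$ and all $w\in\mathcal U$, $\ \langle\mathrm D_u\mathcal E(\hat t(s),\hat u(s),\hat z(s)),w\rangle=0$. Then $(\hat t,\hat u,\hat z)$ is a $\mathcal V$-parameterized balanced viscosity solution, that is, a triple of the above regularity that satisfies 2, 3 and the energy-dissipation balance $$\mathcal E(\hat t(s_1),\hat u(s_1),\hat z(s_1))+\int_0^{s_1}\mathcal R(\hat z'(s))+\|\hat z'(s)\|_{\mathcal V}\,d(s)\,ds=\mathcal E(\hat t(0),\hat u(0),\hat z(0))+\int_0^{s_1}\partial_t\mathcal E(\hat t(s),\hat u(s),\hat z(s))\,\hat t'(s)\,ds\quad\forall s_1\in[0,S],$$ if and only if this relation holds with "$\le$" in place of "$=$" for all $s_1\in[0,S]$. -/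

import Mathlib

open MeasureTheory Set
open scoped ENNReal NNReal

noncomputable section

namespace DamageModel

/-- The plane, with the Euclidean norm. -/
abbrev E2 : Type := EuclideanSpace ℝ (Fin 2)

/-! ### The domain and its boundary parts -/

/-- `Ω` has a Lipschitz boundary: near every boundary point, after a rigid change of coordinates,
`Ω` is the set of points lying strictly above the graph of a Lipschitz function. -/
def HasLipschitzBoundary (Ω : Set E2) : Prop :=
  ∀ x₀ ∈ frontier Ω, ∃ (Φ : E2 ≃ᵃⁱ[ℝ] E2) (r : ℝ) (K : ℝ≥0) (h : ℝ → ℝ),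
    0 < r ∧ LipschitzWith K h ∧ ∀ x ∈ Metric.ball x₀ r, (x ∈ Ω ↔ h (Φ x 0) < Φ x 1)

/-- A bounded Lipschitz domain in the plane with a relatively open Dirichlet part `ΓD`
of positive length and a Neumann part `ΓN` of the boundary. -/
structure Geometry where
  Ω : Set E2
  ΓD : Set E2
  ΓN : Set E2
  isOpen : IsOpen Ω
  isConnected : IsConnected Ω
  isBounded : Bornology.IsBounded Ω
  lipschitz : HasLipschitzBoundary Ω
  frontier_eq : frontier Ω = closure ΓD ∪ closure ΓN
  disjoint : Disjoint ΓD ΓN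
  ΓD_open : ∃ O : Set E2, IsOpen O ∧ ΓD = O ∩ frontier Ω
  ΓD_pos : 0 < Measure.hausdorffMeasure (1 : ℝ) ΓD

/-- Lebesgue measure on `Ω`. -/
def Geometry.μ (G : Geometry) : Measure E2 := volume.restrict G.Ω

instance (G : Geometry) : IsFiniteMeasure G.μ :=
  ⟨by simpa [Geometry.μ] using G.isBounded.measure_lt_top⟩

/-! ### First order Sobolev spaces on `Ω` -/

/-- Smooth compactly supported functions on the plane. -/
def IsTestFunction (φ : E2 → ℝ) : Prop :=
  ContDiff ℝ ((⊤ : ℕ∞) : WithTop ℕ∞) φ ∧ HasCompactSupport φ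

/-- The partial derivative `∂ᵢ φ`. -/
def partialDeriv (i : Fin 2) (φ : E2 → ℝ) (x : E2) : ℝ :=
  fderiv ℝ φ x (EuclideanSpace.single i 1)

variable (F : Type) [NormedAddCommGroup F] [NormedSpace ℝ F]

/-- Values of the gradient of an `F`-valued function: the pair `(∂₀ u, ∂₁ u)`, with the
Euclidean (for vector valued `u`: Frobenius) norm. -/
abbrev GradVal : Type := PiLp 2 (fun _ : Fin 2 => F)

/-- Pairs `(u, g)` of `L^p` functions on `Ω`, `g` being a candidate for the gradient of `u`,
with the norm `(‖u‖_p ^ p + ‖g‖_p ^ p) ^ (1 / p)`. -/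
abbrev FieldPair (G : Geometry) (p : ℝ≥0∞) : Type :=
  WithLp p (Lp F p G.μ × Lp (GradVal F) p G.μ)

variable {F}

/-- The defect `∫_Ω ∂ᵢφ u dx + ∫_Ω φ gᵢ dx` in the integration by parts formula. -/
def greenDefect {G : Geometry} {p : ℝ≥0∞} (w : FieldPair F G p) (i : Fin 2) (φ : E2 → ℝ) : F :=
  (∫ x, partialDeriv i φ x • w.fst x ∂G.μ) + ∫ x, φ x • w.snd x i ∂G.μ

theorem IsTestFunction.continuous_partialDeriv {φ : E2 → ℝ} (hφ : IsTestFunction φ) (i : Fin 2) :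
    Continuous (partialDeriv i φ) :=
  (hφ.1.continuous_fderiv (by simp)).clm_apply continuous_const

theorem IsTestFunction.hasCompactSupport_partialDeriv {φ : E2 → ℝ} (hφ : IsTestFunction φ)
    (i : Fin 2) : HasCompactSupport (partialDeriv i φ) :=
  hφ.2.fderiv_apply ℝ (EuclideanSpace.single i 1)

theorem integrable_smul {G : Geometry} {a : E2 → ℝ} (ha : Continuous a)
    (hc : HasCompactSupport a) {H : Type} [NormedAddCommGroup H] [NormedSpace ℝ H]
    {f : E2 → H} (hf : Integrable f G.μ) : Integrable (fun x => a x • f x) G.μ := by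
  obtain ⟨C, hC⟩ := hc.exists_bound_of_continuous ha
  exact hf.bdd_smul C ha.aestronglyMeasurable (Filter.Eventually.of_forall hC)

section
variable {G : Geometry} {p : ℝ≥0∞} [hp : Fact (1 ≤ p)]

theorem integrable_fst (w : FieldPair F G p) : Integrable (fun x => w.fst x) G.μ :=
  (Lp.memLp w.fst).integrable hp.out

theorem integrable_snd (w : FieldPair F G p) (i : Fin 2) :
    Integrable (fun x => w.snd x i) G.μ :=
  ((PiLp.proj 2 (fun _ : Fin 2 => F) i : _ →L[ℝ] F)).integrable_comp
    ((Lp.memLp w.snd).integrable hp.out)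

theorem greenDefect_add (v w : FieldPair F G p) (i : Fin 2) {φ : E2 → ℝ}
    (hφ : IsTestFunction φ) :
    greenDefect (v + w) i φ = greenDefect v i φ + greenDefect w i φ := by
  have h1 : ∫ x, partialDeriv i φ x • (v + w).fst x ∂G.μ
      = (∫ x, partialDeriv i φ x • v.fst x ∂G.μ) + ∫ x, partialDeriv i φ x • w.fst x ∂G.μ := by
    rw [← integral_add
      (integrable_smul (hφ.continuous_partialDeriv i) (hφ.hasCompactSupport_partialDeriv i)
        (integrable_fst v))
      (integrable_smul (hφ.continuous_partialDeriv i) (hφ.hasCompactSupport_partialDeriv i)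
        (integrable_fst w))]
    refine integral_congr_ae ?_
    filter_upwards [Lp.coeFn_add v.fst w.fst] with x hx
    rw [WithLp.add_fst, hx, Pi.add_apply, smul_add]
  have h2 : ∫ x, φ x • (v + w).snd x i ∂G.μ
      = (∫ x, φ x • v.snd x i ∂G.μ) + ∫ x, φ x • w.snd x i ∂G.μ := by
    rw [← integral_add
      (integrable_smul hφ.1.continuous hφ.2 (integrable_snd v i))
      (integrable_smul hφ.1.continuous hφ.2 (integrable_snd w i))]
    refine integral_congr_ae ?_
    filter_upwards [Lp.coeFn_add v.snd w.snd] with x hx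
    rw [WithLp.add_snd, hx, Pi.add_apply, PiLp.add_apply, smul_add]
  rw [greenDefect, h1, h2, greenDefect, greenDefect]
  abel

theorem greenDefect_smul (c : ℝ) (w : FieldPair F G p) (i : Fin 2) (φ : E2 → ℝ) :
    greenDefect (c • w) i φ = c • greenDefect w i φ := by
  have h1 : ∫ x, partialDeriv i φ x • (c • w).fst x ∂G.μ
      = c • ∫ x, partialDeriv i φ x • w.fst x ∂G.μ := by
    rw [← integral_smul]
    refine integral_congr_ae ?_
    filter_upwards [Lp.coeFn_smul c w.fst] with x hx
    rw [WithLp.smul_fst, hx, Pi.smul_apply, smul_comm]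
  have h2 : ∫ x, φ x • (c • w).snd x i ∂G.μ = c • ∫ x, φ x • w.snd x i ∂G.μ := by
    rw [← integral_smul]
    refine integral_congr_ae ?_
    filter_upwards [Lp.coeFn_smul c w.snd] with x hx
    rw [WithLp.smul_snd, hx, Pi.smul_apply, PiLp.smul_apply, smul_comm]
  rw [greenDefect, h1, h2, greenDefect, smul_add]

theorem greenDefect_zero (i : Fin 2) (φ : E2 → ℝ) :
    greenDefect (0 : FieldPair F G p) i φ = 0 := by
  simpa using greenDefect_smul (0 : ℝ) (0 : FieldPair F G p) i φ

theorem continuous_integral_smul {H : Type} [NormedAddCommGroup H] [NormedSpace ℝ H]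
    {a : E2 → ℝ} (ha : Continuous a) (hc : HasCompactSupport a) :
    Continuous (fun f : Lp H p G.μ => ∫ x, a x • f x ∂G.μ) := by
  have hint (f : Lp H p G.μ) : Integrable f G.μ := (Lp.memLp f).integrable hp.out
  obtain ⟨C, hC⟩ := hc.exists_bound_of_continuous ha
  have hC0 : 0 ≤ C := (norm_nonneg _).trans (hC 0)
  let L : Lp H p G.μ →ₗ[ℝ] H :=
    { toFun := fun f => ∫ x, a x • f x ∂G.μ
      map_add' := fun f g => by
        rw [← integral_add (integrable_smul ha hc (hint f)) (integrable_smul ha hc (hint g))]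
        refine integral_congr_ae ?_
        filter_upwards [Lp.coeFn_add f g] with x hx
        rw [hx, Pi.add_apply, smul_add]
      map_smul' := fun c f => by
        rw [RingHom.id_apply, ← integral_smul]
        refine integral_congr_ae ?_
        filter_upwards [Lp.coeFn_smul c f] with x hx
        rw [hx, Pi.smul_apply, smul_comm] }
  set m : ℝ≥0∞ := G.μ univ ^ (1 / (1 : ℝ≥0∞).toReal - 1 / p.toReal) with hm
  have hm' : m ≠ ⊤ := by
    refine ENNReal.rpow_ne_top_of_nonneg ?_ (measure_ne_top _ _)
    rcases eq_or_ne p ⊤ with rfl | h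
    · simp
    · have : 1 ≤ p.toReal := by simpa using ENNReal.toReal_mono h hp.out
      simpa using inv_le_one_of_one_le₀ this
  refine (L.mkContinuous (C * m.toReal) fun f => ?_).continuous
  calc ‖∫ x, a x • f x ∂G.μ‖ ≤ ∫ x, C * ‖f x‖ ∂G.μ := by
        refine norm_integral_le_of_norm_le ((hint f).norm.const_mul C)
          (Filter.Eventually.of_forall fun x => ?_)
        rw [norm_smul]
        exact mul_le_mul_of_nonneg_right (hC x) (norm_nonneg _)
    _ = C * (eLpNorm f 1 G.μ).toReal := by
        rw [integral_const_mul, integral_norm_eq_lintegral_enorm (hint f).1,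
          eLpNorm_one_eq_lintegral_enorm]
    _ ≤ C * (eLpNorm f p G.μ * m).toReal := by
        refine mul_le_mul_of_nonneg_left (ENNReal.toReal_mono
          (ENNReal.mul_ne_top (Lp.eLpNorm_ne_top f) hm') ?_) hC0
        exact eLpNorm_le_eLpNorm_mul_rpow_measure_univ hp.out (Lp.aestronglyMeasurable f)
    _ = C * m.toReal * ‖f‖ := by
        rw [ENNReal.toReal_mul, Lp.norm_def]
        ring

theorem continuous_greenDefect [CompleteSpace F] (i : Fin 2) {φ : E2 → ℝ}
    (hφ : IsTestFunction φ) : Continuous (fun w : FieldPair F G p => greenDefect w i φ) := by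
  have h2 (w : FieldPair F G p) :
      ∫ x, φ x • w.snd x i ∂G.μ = PiLp.proj (𝕜 := ℝ) 2 (fun _ : Fin 2 => F) i
        (∫ x, φ x • w.snd x ∂G.μ) := by
    rw [← ContinuousLinearMap.integral_comp_comm _
      (integrable_smul hφ.1.continuous hφ.2 ((Lp.memLp w.snd).integrable hp.out))]
    simp
  unfold greenDefect
  simp only [h2]
  exact ((continuous_integral_smul (hφ.continuous_partialDeriv i)
      (hφ.hasCompactSupport_partialDeriv i)).comp (WithLp.continuous_fst ..)).add
    ((ContinuousLinearMap.continuous _).comp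
      ((continuous_integral_smul hφ.1.continuous hφ.2).comp (WithLp.continuous_snd ..)))

end

variable (F)

/-- The Sobolev space `W^{1,p}(Ω; F)`: pairs `(u, ∇u)` in `L^p`, where `∇u` is the weak gradient
of `u`, that is, integration by parts holds against all test functions supported in `Ω`. -/
def sobolev (G : Geometry) (p : ℝ≥0∞) [Fact (1 ≤ p)] : Submodule ℝ (FieldPair F G p) where
  carrier := {w | ∀ i φ, IsTestFunction φ → tsupport φ ⊆ G.Ω → greenDefect w i φ = 0}
  add_mem' hv hw i φ hφ h := by rw [greenDefect_add _ _ _ hφ, hv i φ hφ h, hw i φ hφ h, add_zero]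
  zero_mem' i φ _ _ := greenDefect_zero i φ
  smul_mem' c _ hw i φ hφ h := by rw [greenDefect_smul, hw i φ hφ h, smul_zero]

/-- The space `W^{1,p}_{ΓD}(Ω; F)` of the `u ∈ W^{1,p}(Ω; F)` with `u = 0` on `ΓD`.
On a Lipschitz domain with outer unit normal `ν`, the Gauss-Green formula says that
`∫_Ω (∂ᵢφ u + φ ∂ᵢu) dx = ∫_{∂Ω} φ u νᵢ dH¹` for all test functions `φ` on the plane, where the
boundary values of `u` are those of its trace. Hence the trace of `u` vanishes on the relatively
open set `ΓD` if and only if the left-hand side vanishes for all `i` and all `φ` whose support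
does not meet `∂Ω \ ΓD`. -/
def sobolevD (G : Geometry) (p : ℝ≥0∞) [Fact (1 ≤ p)] : Submodule ℝ (FieldPair F G p) where
  carrier := {w | w ∈ sobolev F G p ∧ ∀ i φ, IsTestFunction φ →
    Disjoint (tsupport φ) (frontier G.Ω \ G.ΓD) → greenDefect w i φ = 0}
  add_mem' hv hw := ⟨add_mem hv.1 hw.1, fun i φ hφ h => by
    rw [greenDefect_add _ _ _ hφ, hv.2 i φ hφ h, hw.2 i φ hφ h, add_zero]⟩
  zero_mem' := ⟨zero_mem _, fun i φ _ _ => greenDefect_zero i φ⟩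
  smul_mem' c _ hw := ⟨Submodule.smul_mem _ c hw.1, fun i φ hφ h => by
    rw [greenDefect_smul, hw.2 i φ hφ h, smul_zero]⟩

variable {F}

theorem isClosed_sobolev [CompleteSpace F] (G : Geometry) (p : ℝ≥0∞) [Fact (1 ≤ p)] :
    IsClosed (sobolev F G p : Set (FieldPair F G p)) := by
  have : (sobolev F G p : Set (FieldPair F G p)) = ⋂ (i : Fin 2) (φ : E2 → ℝ)
      (_ : IsTestFunction φ) (_ : tsupport φ ⊆ G.Ω), {w | greenDefect w i φ = 0} := by
    ext w
    simp only [mem_iInter]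
    rfl
  rw [this]
  exact isClosed_iInter fun i => isClosed_iInter fun φ => isClosed_iInter fun hφ =>
    isClosed_iInter fun _ => isClosed_eq (continuous_greenDefect i hφ) continuous_const

theorem isClosed_sobolevD [CompleteSpace F] (G : Geometry) (p : ℝ≥0∞) [Fact (1 ≤ p)] :
    IsClosed (sobolevD F G p : Set (FieldPair F G p)) := by
  have : (sobolevD F G p : Set (FieldPair F G p)) = (sobolev F G p : Set (FieldPair F G p)) ∩
      ⋂ (i : Fin 2) (φ : E2 → ℝ) (_ : IsTestFunction φ)
        (_ : Disjoint (tsupport φ) (frontier G.Ω \ G.ΓD)), {w | greenDefect w i φ = 0} := by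
    ext w
    simp only [mem_inter_iff, mem_iInter]
    rfl
  rw [this]
  exact (isClosed_sobolev G p).inter <| isClosed_iInter fun i => isClosed_iInter fun φ =>
    isClosed_iInter fun hφ => isClosed_iInter fun _ =>
      isClosed_eq (continuous_greenDefect i hφ) continuous_const

/-- `W^{1,p}(Ω; F)` is a Banach space, so Bochner integrals with values in it are meaningful. -/
instance [CompleteSpace F] (G : Geometry) (p : ℝ≥0∞) [Fact (1 ≤ p)] :
    CompleteSpace (sobolev F G p) :=
  (isClosed_sobolev G p).completeSpace_coe

instance [CompleteSpace F] (G : Geometry) (p : ℝ≥0∞) [Fact (1 ≤ p)] :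
    CompleteSpace (sobolevD F G p) :=
  (isClosed_sobolevD G p).completeSpace_coe

/-- The phase-field space `Z = H¹(Ω)`, with `‖z‖² = ‖z‖²_{L²} + ‖∇z‖²_{L²}`. -/
abbrev Z (G : Geometry) : Type := sobolev ℝ G 2

/-- The displacement spaces `U^p = W^{1,p}_{ΓD}(Ω; ℝ²)`. -/
abbrev U (G : Geometry) (p : ℝ≥0∞) [Fact (1 ≤ p)] : Type := sobolevD E2 G p

/-- The function underlying an element of `Z` (defined up to null sets). -/
def Z.fn {G : Geometry} (z : Z G) : E2 → ℝ := fun x => z.1.fst x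

/-- The gradient of an element of `U^p`: `∂ᵢ uⱼ (x)` is `u.grad x i j`. -/
def U.grad {G : Geometry} {p : ℝ≥0∞} [Fact (1 ≤ p)] (u : U G p) : E2 → GradVal E2 :=
  fun x => u.1.snd x

/-- Lowering the integrability exponent of a pair, `Ω` being bounded. -/
def FieldPair.lower {G : Geometry} {q r : ℝ≥0∞} (h : q ≤ r) (w : FieldPair F G r) :
    FieldPair F G q :=
  WithLp.toLp q (((Lp.memLp w.fst).mono_exponent h).toLp _,
    ((Lp.memLp w.snd).mono_exponent h).toLp _)

theorem greenDefect_lower {G : Geometry} {q r : ℝ≥0∞} (h : q ≤ r) (w : FieldPair F G r)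
    (i : Fin 2) (φ : E2 → ℝ) : greenDefect (w.lower h) i φ = greenDefect w i φ := by
  unfold greenDefect
  congr 1
  · refine integral_congr_ae ?_
    filter_upwards [((Lp.memLp w.fst).mono_exponent h).coeFn_toLp] with x hx
    exact congrArg _ hx
  · refine integral_congr_ae ?_
    filter_upwards [((Lp.memLp w.snd).mono_exponent h).coeFn_toLp] with x hx
    exact congrArg (fun y : GradVal F => φ x • y i) hx

/-- The embedding `U^r ↪ U^q` for `q ≤ r`. -/
def U.lower {G : Geometry} {q r : ℝ≥0∞} [Fact (1 ≤ q)] [Fact (1 ≤ r)] (h : q ≤ r) (u : U G r) :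
    U G q :=
  ⟨u.1.lower h,
    fun i φ hφ hs => by rw [greenDefect_lower]; exact u.2.1 i φ hφ hs,
    fun i φ hφ hs => by rw [greenDefect_lower]; exact u.2.2 i φ hφ hs⟩

/-! ### Exponents -/

/-- The integrability exponent `p > 2` and the exponent `α ≥ 3p / (p - 2)` of `V = L^α(Ω)`. -/
structure Exponents where
  p : ℝ
  α : ℝ
  two_lt_p : 2 < p
  le_α : 3 * p / (p - 2) ≤ α

namespace Exponents

/-- The conjugate exponent `p' = p / (p - 1)`. -/
def pConj (e : Exponents) : ℝ≥0∞ := ENNReal.ofReal (e.p / (e.p - 1))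

/-- The exponent `p̃ = 3p / (p + 1)`. -/
def pTilde (e : Exponents) : ℝ≥0∞ := ENNReal.ofReal (3 * e.p / (e.p + 1))

/-- The exponent `α`. -/
def alpha (e : Exponents) : ℝ≥0∞ := ENNReal.ofReal e.α

theorem pConj_le_two (e : Exponents) : e.pConj ≤ 2 := by
  have := e.two_lt_p
  rw [pConj, show (2 : ℝ≥0∞) = ENNReal.ofReal 2 by simp]
  refine ENNReal.ofReal_le_ofReal ?_
  rw [div_le_iff₀ (by linarith)]
  linarith

theorem two_le_pTilde (e : Exponents) : 2 ≤ e.pTilde := by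
  have := e.two_lt_p
  rw [pTilde, show (2 : ℝ≥0∞) = ENNReal.ofReal 2 by simp]
  refine ENNReal.ofReal_le_ofReal ?_
  rw [le_div_iff₀ (by linarith)]
  linarith

instance (e : Exponents) : Fact (1 ≤ e.pConj) := ⟨by
  have := e.two_lt_p
  rw [pConj, ENNReal.one_le_ofReal, le_div_iff₀ (by linarith)]
  linarith⟩

instance (e : Exponents) : Fact (1 ≤ e.pTilde) :=
  ⟨le_trans (by norm_num) e.two_le_pTilde⟩

instance (e : Exponents) : Fact (1 ≤ e.alpha) := ⟨by
  have := e.two_lt_p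
  rw [alpha, ENNReal.one_le_ofReal]
  refine le_trans ?_ e.le_α
  rw [le_div_iff₀ (by linarith)]
  linarith⟩

end Exponents

/-- The space `V = L^α(Ω)`. -/
abbrev V (G : Geometry) (e : Exponents) : Type := Lp ℝ e.alpha G.μ

/-! ### The data of the model -/

/-- Symmetric `2 × 2` matrices. -/
def SymMat : Submodule ℝ (Matrix (Fin 2) (Fin 2) ℝ) where
  carrier := {A | A.IsSymm}
  add_mem' hA hB := hA.add hB
  zero_mem' := Matrix.isSymm_zero
  smul_mem' c _ hA := hA.smul c

/-- The Frobenius inner product `A : B = tr (Bᵀ A)`. -/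
def frob (A B : SymMat) : ℝ := (B.1.transpose * A.1).trace

/-- The symmetric part `(∇u + (∇u)ᵀ) / 2` of a gradient. -/
def symPart (g : GradVal E2) : SymMat :=
  ⟨Matrix.of fun i j => (g i j + g j i) / 2, by
    refine Matrix.IsSymm.ext fun i j => ?_
    simp [add_comm]⟩

/-- The linearized strain `ε(u)`. -/
def strain {G : Geometry} {p : ℝ≥0∞} [Fact (1 ≤ p)] (u : U G p) (x : E2) : SymMat :=
  symPart (u.grad x)

/-- Material parameters, elastic tensor and external loading on the time interval `[0, T]`. -/
structure Model (G : Geometry) (e : Exponents) where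
  T : ℝ
  κ : ℝ
  η : ℝ
  /-- the elastic tensor -/
  C : E2 → SymMat →ₗ[ℝ] SymMat
  /-- the external loading -/
  ℓ : ℝ → StrongDual ℝ (U G e.pConj)
  T_pos : 0 < T
  κ_pos : 0 < κ
  η_pos : 0 < η
  /-- `C` belongs to `L^∞`; this is expressed by the entries of `C(x) A` for every `A` -/
  C_bdd : ∀ (A : SymMat) (i j : Fin 2), MemLp (fun x => (C x A).1 i j) ⊤ G.μ
  C_coercive : ∃ γ : ℝ, 0 < γ ∧ ∀ A : SymMat, ∀ᵐ x ∂G.μ, γ * frob A A ≤ frob (C x A) A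
  C_symm : ∀ A B : SymMat, ∀ᵐ x ∂G.μ, frob (C x A) B = frob (C x B) A
  /-- `ℓ` belongs to `C^{1,1}` on `[0, T]` -/
  ℓ_reg : ∃ (ℓ' : ℝ → StrongDual ℝ (U G e.pConj)) (K : ℝ≥0),
    (∀ t ∈ Icc 0 T, HasDerivWithinAt ℓ (ℓ' t) (Icc 0 T) t) ∧ LipschitzOnWith K ℓ' (Icc 0 T)

variable {G : Geometry} {e : Exponents}

namespace Model

variable (M : Model G e)

/-! ### Energy and dissipation -/

/-- The energy `E(t,u,z) = κ/2 ‖z‖² + 1/2 ∫_Ω (z² + η) C ε(u) : ε(u) dx - ⟨ℓ(t), u⟩`. It is used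
here only where it is finite, that is for `u ∈ U^{p̃}` or for `z` with values in `[0, 1]`; in
these cases the integrand is integrable. -/
def energy (t : ℝ) (u : U G 2) (z : Z G) : ℝ :=
  M.κ / 2 * ‖z‖ ^ 2
    + 1 / 2 * (∫ x, (z.fn x ^ 2 + M.η) * frob (M.C x (strain u x)) (strain u x) ∂G.μ)
    - M.ℓ t (u.lower e.pConj_le_two)

/-- The energy on `U^{p̃}`. -/
def energyT (t : ℝ) (u : U G e.pTilde) (z : Z G) : ℝ :=
  M.energy t (u.lower e.two_le_pTilde) z

/-- The partial derivative `∂ₜ E(t,u,z)` on `[0, T]`. -/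
def dtE (t : ℝ) (u : U G e.pTilde) (z : Z G) : ℝ :=
  derivWithin (fun τ => M.energyT τ u z) (Icc 0 M.T) t

/-- The Fréchet derivative `D_z E(t,u,z) ∈ Z*` of `E(t,u,·) : Z → ℝ`. -/
def dzE (t : ℝ) (u : U G e.pTilde) (z : Z G) : StrongDual ℝ (Z G) :=
  fderiv ℝ (fun ζ => M.energyT t u ζ) z

/-- The pairing `⟨D_u E(t,u,z), w⟩ = ∫_Ω (z² + η) C ε(u) : ε(w) dx - ⟨ℓ(t), w⟩` with `w ∈ U`;
it extends the Fréchet derivative of `E(t,·,z)` on `U^{p̃}`. -/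
def duE (t : ℝ) (u : U G e.pTilde) (z : Z G) (w : U G 2) : ℝ :=
  (∫ x, (z.fn x ^ 2 + M.η) * frob (M.C x (strain u x)) (strain w x) ∂G.μ)
    - M.ℓ t (w.lower e.pConj_le_two)

open Classical in
/-- The dissipation potential `R(v) = ∫_Ω κ |v| dx` if `v ≤ 0` a.e. in `Ω`, and `R(v) = ∞`
otherwise. -/
def dissipation (v : E2 → ℝ) : ℝ≥0∞ :=
  if ∀ᵐ x ∂G.μ, v x ≤ 0 then ∫⁻ x, ENNReal.ofReal (M.κ * |v x|) ∂G.μ else ⊤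

end Model

/-- The subdifferential of `f : Q → ℝ ∪ {∞}` at `u`. -/
def subdifferential {Q : Type} [NormedAddCommGroup Q] [NormedSpace ℝ Q] (f : Q → EReal) (u : Q) :
    Set (StrongDual ℝ Q) :=
  {ξ | ∀ v, f u + ((ξ (v - u) : ℝ) : EReal) ≤ f v}

/-- The functional `ξ` on `Z` is the restriction to `Z` of the functional `θ` on `V`
(the embedding of `Z` into `V` identifies functions that agree a.e. in `Ω`). -/
def IsRestriction (ξ : StrongDual ℝ (Z G)) (θ : StrongDual ℝ (V G e)) : Prop :=
  ∀ (z : Z G) (v : V G e), z.fn =ᵐ[G.μ] v → ξ z = θ v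

/-- The distance `dist_{V*}(ζ, A) = inf {‖ζ - σ‖_{V*} : σ ∈ A, ζ - σ ∈ V*}` of `ζ ∈ Z*` to a set
`A ⊆ Z*`; it is `∞` if there is no `σ ∈ A` with `ζ - σ ∈ V*`. -/
def distVstar (e : Exponents) (ζ : StrongDual ℝ (Z G)) (A : Set (StrongDual ℝ (Z G))) : ℝ≥0∞ :=
  ⨅ (σ : StrongDual ℝ (Z G)) (_ : σ ∈ A) (θ : StrongDual ℝ (V G e)) (_ : IsRestriction (ζ - σ) θ),
    ENNReal.ofReal ‖θ‖

namespace Model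

variable (M : Model G e)

/-- The set `∂^Z R(0)`. -/
def stableSet : Set (StrongDual ℝ (Z G)) :=
  subdifferential (fun v : Z G => (M.dissipation v.fn : EReal)) 0

/-- `dist_{V*}(-D_z E(t,u,z), ∂^Z R(0))`. -/
def slope (t : ℝ) (u : U G e.pTilde) (z : Z G) : ℝ≥0∞ :=
  distVstar e (-M.dzE t u z) M.stableSet

end Model

/-! ### Vector valued Sobolev functions on an interval -/

/-- `f` is (the continuous representative on `[0, S]` of) an element of `W^{1,q}((0,S); X)`:
`f` and its distributional derivative belong to `L^q((0,S); X)`. The derivative then exists in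
the classical sense, as `deriv f s`, for almost every `s ∈ (0, S)`. -/
def MemW1 {X : Type} [NormedAddCommGroup X] [NormedSpace ℝ X] (q : ℝ≥0∞) (S : ℝ) (f : ℝ → X) :
    Prop :=
  ContinuousOn f (Icc 0 S) ∧ MemLp f q (volume.restrict (Ioo 0 S)) ∧
    ∃ g : ℝ → X, MemLp g q (volume.restrict (Ioo 0 S)) ∧
      ∀ φ : ℝ → ℝ, ContDiff ℝ ((⊤ : ℕ∞) : WithTop ℕ∞) φ → HasCompactSupport φ →
        tsupport φ ⊆ Ioo 0 S →
        ∫ s in Ioo 0 S, deriv φ s • f s = -∫ s in Ioo 0 S, φ s • g s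

/-- `z : [0,S] → Z`, regarded as a map into `V`, belongs to `W^{1,∞}((0,S); V)`. -/
def MemW1InftyV (e : Exponents) (S : ℝ) (z : ℝ → Z G) : Prop :=
  ∃ zV : ℝ → V G e, (∀ s ∈ Icc 0 S, (z s).fn =ᵐ[G.μ] zV s) ∧ MemW1 ⊤ S zV

/-- The regularity class of parameterized solutions. -/
structure IsAdmissible (S : ℝ) (t : ℝ → ℝ) (u : ℝ → U G e.pTilde) (z : ℝ → Z G) : Prop where
  t_mem : MemW1 ⊤ S t
  u_mem : MemW1 ⊤ S u
  z_memV : MemW1InftyV e S z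
  z_memZ : MemW1 2 S z

/-- `‖v‖_V = ‖v‖_{L^α(Ω)}` of `v ∈ Z`. -/
def normV (e : Exponents) (v : Z G) : ℝ≥0∞ := eLpNorm v.fn e.alpha G.μ

namespace Model

variable (M : Model G e)

/-! ### The conditions on a parameterized triple -/

/-- The initial conditions with initial time `0` and initial phase-field `z₀`; the initial
displacement is the minimizer of `E(0,·,z₀)` over `U`, and the final time `T` is reached. -/
structure InitialConditions (z₀ : Z G) (S : ℝ) (t : ℝ → ℝ) (u : ℝ → U G e.pTilde)
    (z : ℝ → Z G) : Prop where
  t_zero : t 0 = 0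
  t_end : t S = M.T
  u_zero : ∀ w : U G 2, M.energy 0 ((u 0).lower e.two_le_pTilde) z₀ ≤ M.energy 0 w z₀
  z_zero : z 0 = z₀

/-- The complementarity relations (with `0 * ∞ = 0`). -/
def Complementarity (S : ℝ) (t : ℝ → ℝ) (u : ℝ → U G e.pTilde) (z : ℝ → Z G) : Prop :=
  ∀ᵐ s ∂(volume.restrict (Icc 0 S)),
    0 ≤ deriv t s ∧ ENNReal.ofReal (deriv t s) + normV e (deriv z s) ≤ 1 ∧
      ENNReal.ofReal (deriv t s) * M.slope (t s) (u s) (z s) = 0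

/-- The balance of linear momentum. -/
def MomentumBalance (S : ℝ) (t : ℝ → ℝ) (u : ℝ → U G e.pTilde) (z : ℝ → Z G) : Prop :=
  ∀ᵐ s ∂(volume.restrict (Icc 0 S)), ∀ w : U G 2, M.duE (t s) (u s) (z s) w = 0

/-- The energy at `s₁` plus the dissipated energy up to `s₁`,
`E(t(s₁),u(s₁),z(s₁)) + ∫₀^{s₁} R(z'(s)) + ‖z'(s)‖_V dist_{V*}(-D_z E, ∂^Z R(0)) ds`,
possibly `∞` (with `0 * ∞ = 0` in the integrand). -/
def storedPlusDissipated (t : ℝ → ℝ) (u : ℝ → U G e.pTilde) (z : ℝ → Z G) (s₁ : ℝ) : EReal :=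
  (M.energyT (t s₁) (u s₁) (z s₁) : EReal) +
    ((∫⁻ s in Icc 0 s₁, (M.dissipation (deriv z s).fn
      + normV e (deriv z s) * M.slope (t s) (u s) (z s)) : ℝ≥0∞) : EReal)

/-- The initial energy plus the work of the external loading up to `s₁`,
`E(t(0),u(0),z(0)) + ∫₀^{s₁} ∂ₜE(t(s),u(s),z(s)) t'(s) ds`. -/
def initialPlusWork (t : ℝ → ℝ) (u : ℝ → U G e.pTilde) (z : ℝ → Z G) (s₁ : ℝ) : ℝ :=
  M.energyT (t 0) (u 0) (z 0) + ∫ s in (0 : ℝ)..s₁, M.dtE (t s) (u s) (z s) * deriv t s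

/-- The energy-dissipation inequality. -/
def EnergyInequality (S : ℝ) (t : ℝ → ℝ) (u : ℝ → U G e.pTilde) (z : ℝ → Z G) : Prop :=
  ∀ s₁ ∈ Icc 0 S, M.storedPlusDissipated t u z s₁ ≤ (M.initialPlusWork t u z s₁ : EReal)

/-- The energy-dissipation balance. -/
def EnergyBalance (S : ℝ) (t : ℝ → ℝ) (u : ℝ → U G e.pTilde) (z : ℝ → Z G) : Prop :=
  ∀ s₁ ∈ Icc 0 S, M.storedPlusDissipated t u z s₁ = (M.initialPlusWork t u z s₁ : EReal)

/-- `V`-parameterized balanced viscosity solutions of the rate-independent system driven by the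
energy `E` and the dissipation potential `R`. -/
structure IsBVSolution (S : ℝ) (t : ℝ → ℝ) (u : ℝ → U G e.pTilde) (z : ℝ → Z G) : Prop where
  admissible : IsAdmissible S t u z
  complementarity : M.Complementarity S t u z
  momentum : M.MomentumBalance S t u z
  energy_balance : M.EnergyBalance S t u z

end Model

end DamageModel

end

open MeasureTheory Set
open scoped ENNReal NNReal

noncomputable section

namespace DamageModel

/-! ### Gagliardo's inequality in skew coordinates -/

/-! The balance trivially implies the inequality. For the converse, the opposite inequality holds
along every admissible curve satisfying conditions 1–3. The chain rule gives, for a.a. `s`, `d/ds E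
= ⟨D_z E, z'⟩ + ⟨D_u E, u'⟩ + ∂ₜE t'`. The middle term vanishes by the momentum balance tested with
`u'`. If `-D_z E = σ + θ` with `σ ∈ ∂R(0)` and `θ ∈ V*`, then `-⟨D_z E, z'⟩ ≤ R(z') + ‖θ‖ ‖z'‖_V`,
and the infimum over such splittings bounds it by `R(z') + ‖z'‖_V d` (`ofReal_neg_dzE_le`).
Integrating over `[0, s₁]` gives `initialPlusWork_le_storedPlusDissipated`.

The analytic work lies in the chain rule: `s ↦ E(t(s), u(s), z(s))` must be absolutely continuous
and differentiable a.e. The elastic term is a bounded quadratic form in `z∇u` and `∇u`, so it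
suffices that `(z, u) ↦ z∇u` is bounded from `H¹ × U^{p̃}` to `L²` (`mulGrad`). By Hölder this
follows from `H¹(Ω) ⊆ L^q(Ω)` with `1/q + 1/p̃ = 1/2`.

That embedding is proved on the Lipschitz domain without an extension operator. Near each point of
`closure Ω` some cone of directions keeps `Ω` locally invariant (`exists_coneStable`). Gagliardo's
argument along the two edges of the cone needs values inside `Ω` only. Mollifiers supported in the
opposite cone make the convolution at `x ∈ Ω` see only points of `Ω` near the cut-off, so it
commutes with the weak derivative there (`mollify_fderiv_cutoff`). Uniform bounds and Fatou's lemma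
conclude.

In the parameter `s`, a continuous `W^{1,q}` function is the primitive of its weak derivative, hence
absolutely continuous and differentiable a.e. -/

theorem enorm_le_lintegral_line {f : E2 → ℝ} (hf : ContDiff ℝ 1 f) (hc : HasCompactSupport f)
    {v : E2} (hv : v ≠ 0) {D : Set E2} {x : E2}
    (hD : ∀ s : ℝ, 0 ≤ s → x + s • v ∈ tsupport f → x + s • v ∈ D) :
    ‖f x‖ₑ ≤ ∫⁻ s : ℝ, D.indicator (fun y => ‖fderiv ℝ f y v‖ₑ) (x + s • v) := by
  set g : ℝ → ℝ := fun s => f (x + s • v) with hg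
  have hgd : ContDiff ℝ 1 g := hf.comp (contDiff_const.add (contDiff_id.smul contDiff_const))
  have hgc : HasCompactSupport g :=
    hc.comp_isClosedEmbedding
      ((Homeomorph.addLeft x).isClosedEmbedding.comp (isClosedEmbedding_smul_left hv))
  have hder (s : ℝ) : deriv g s = fderiv ℝ f (x + s • v) v := by
    have h1 : HasDerivAt (fun s : ℝ => x + s • v) v s := by
      simpa using ((hasDerivAt_id s).smul_const v).const_add x
    exact ((hf.differentiable one_ne_zero _).hasFDerivAt.comp_hasDerivAt s h1).deriv
  calc ‖f x‖ₑ = ‖∫ s in Ioi (0 : ℝ), deriv g s‖ₑ := by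
        rw [hgc.integral_Ioi_deriv_eq hgd 0, enorm_neg]
        simp [hg]
    _ ≤ ∫⁻ s in Ioi (0 : ℝ), ‖deriv g s‖ₑ := enorm_integral_le_lintegral_enorm _
    _ ≤ ∫⁻ s in Ioi (0 : ℝ), D.indicator (fun y => ‖fderiv ℝ f y v‖ₑ) (x + s • v) := by
        refine setLIntegral_mono' measurableSet_Ioi fun s hs => ?_
        rw [hder]
        by_cases h : x + s • v ∈ tsupport f
        · rw [indicator_of_mem (hD s (le_of_lt hs) h)]
        · have : fderiv ℝ f (x + s • v) = 0 := by
            by_contra h'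
            exact h (support_fderiv_subset ℝ h')
          simp [this]
    -- Passing to the whole line makes the bound depend on the line only, not on the position of `x`
    -- on it.
    _ ≤ _ := setLIntegral_le_lintegral _ _

/-- Uniqueness of Haar measure replaces the determinant: only `0 < c < ∞` matters for the Gagliardo
estimate. -/
theorem exists_lintegral_eq_smul_prod (L : (ℝ × ℝ) ≃L[ℝ] E2) :
    ∃ c : ℝ≥0∞, c ≠ 0 ∧ c ≠ ⊤ ∧ ∀ g : E2 → ℝ≥0∞, Measurable g →
      ∫⁻ x, g x = c * ∫⁻ a : ℝ, ∫⁻ b : ℝ, g (L (a, b)) := by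
  set ν : Measure E2 := (volume : Measure (ℝ × ℝ)).map L
  have hν : ν.IsAddHaarMeasure := L.isAddHaarMeasure_map _
  refine ⟨Measure.addHaarScalarFactor volume ν, ?_, ENNReal.coe_ne_top, fun g hg => ?_⟩
  · exact_mod_cast (Measure.addHaarScalarFactor_pos_of_isAddHaarMeasure volume ν).ne'
  · have h : (volume : Measure E2) = Measure.addHaarScalarFactor volume ν • ν :=
      Measure.isAddLeftInvariant_eq_smul _ _
    conv_lhs => rw [h]
    rw [lintegral_smul_measure, ENNReal.smul_def, smul_eq_mul,
      lintegral_map hg L.continuous.measurable, Measure.volume_eq_prod,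
      lintegral_prod (fun p => g (L p)) (hg.comp L.continuous.measurable).aemeasurable]

/-- The Sobolev inequality `W^{1,1} ⊆ L²` on a set `D` that is stable, within the support of `f`,
under translations in the cone spanned by two directions. -/
theorem exists_lintegral_sq_le (L : (ℝ × ℝ) ≃L[ℝ] E2) :
    ∃ c : ℝ≥0∞, c ≠ ⊤ ∧ ∀ (D : Set E2), MeasurableSet D → ∀ f : E2 → ℝ, ContDiff ℝ 1 f →
      HasCompactSupport f →
      (∀ x ∈ D, ∀ a b : ℝ, 0 ≤ a → 0 ≤ b → x + L (a, b) ∈ tsupport f → x + L (a, b) ∈ D) →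
      ∫⁻ x in D, ‖f x‖ₑ ^ 2 ≤ c * ((∫⁻ x in D, ‖fderiv ℝ f x (L (1, 0))‖ₑ) *
        ∫⁻ x in D, ‖fderiv ℝ f x (L (0, 1))‖ₑ) := by
  obtain ⟨c, hc0, hc, hL⟩ := exists_lintegral_eq_smul_prod L
  refine ⟨c⁻¹, ENNReal.inv_ne_top.2 hc0, fun D hD f hf hfc hcone => ?_⟩
  have hmeas (v : E2) : Measurable (D.indicator fun y => ‖fderiv ℝ f y v‖ₑ) :=
    (((hf.continuous_fderiv one_ne_zero).clm_apply continuous_const).enorm.measurable).indicator hD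
  have hsum (a b : ℝ) : L (a, b) = a • L (1, 0) + b • L (0, 1) := by
    rw [← map_smul, ← map_smul, ← map_add]
    simp
  have hne1 : L (1, 0) ≠ 0 := by simp
  have hne2 : L (0, 1) ≠ 0 := by simp
  set H1 := D.indicator fun y => ‖fderiv ℝ f y (L (1, 0))‖ₑ with hH1
  set H2 := D.indicator fun y => ‖fderiv ℝ f y (L (0, 1))‖ₑ with hH2
  set A : ℝ → ℝ≥0∞ := fun b => ∫⁻ a : ℝ, H1 (L (a, b)) with hA
  set B : ℝ → ℝ≥0∞ := fun a => ∫⁻ b : ℝ, H2 (L (a, b)) with hB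
  have hAm : Measurable A :=
    ((hmeas _).comp L.continuous.measurable).lintegral_prod_left'
  have hBm : Measurable B :=
    ((hmeas _).comp L.continuous.measurable).lintegral_prod_right'
  -- Bounding one factor `|f|` along each edge direction separates the variables: the line integral
  -- in the first direction depends on `b` only, that in the second on `a` only.
  have key (a b : ℝ) : D.indicator (fun x => ‖f x‖ₑ ^ 2) (L (a, b)) ≤ B a * A b := by
    by_cases hx : L (a, b) ∈ D
    · rw [indicator_of_mem hx, sq, mul_comm (B a)]
      refine mul_le_mul' ?_ ?_
      · refine (enorm_le_lintegral_line hf hfc hne1 (D := D) fun s hs h => ?_).trans_eq ?_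
        · have := hcone _ hx s 0 hs le_rfl
          simp only [hsum s 0, zero_smul, add_zero] at this
          exact this h
        · refine Eq.trans (lintegral_congr fun s => ?_)
            (lintegral_add_left_eq_self (fun s => H1 (L (s, b))) a)
          rw [hsum a b, hsum (a + s) b]
          congr 1
          module
      · refine (enorm_le_lintegral_line hf hfc hne2 (D := D) fun s hs h => ?_).trans_eq ?_
        · have := hcone _ hx 0 s le_rfl hs
          simp only [hsum 0 s, zero_smul, zero_add] at this
          exact this h
        · refine Eq.trans (lintegral_congr fun s => ?_)
            (lintegral_add_left_eq_self (fun s => H2 (L (a, s))) b)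
          rw [hsum a b, hsum a (b + s)]
          congr 1
          module
    · rw [indicator_of_notMem hx]
      exact zero_le
  have e1 : ∫⁻ x in D, ‖fderiv ℝ f x (L (1, 0))‖ₑ = c * ∫⁻ b, A b := by
    rw [← lintegral_indicator hD, hL _ (hmeas _), lintegral_lintegral_swap]
    exact ((hmeas _).comp L.continuous.measurable).aemeasurable
  have e2 : ∫⁻ x in D, ‖fderiv ℝ f x (L (0, 1))‖ₑ = c * ∫⁻ a, B a := by
    rw [← lintegral_indicator hD, hL _ (hmeas _)]
  calc ∫⁻ x in D, ‖f x‖ₑ ^ 2 = ∫⁻ x, D.indicator (fun x => ‖f x‖ₑ ^ 2) x :=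
        (lintegral_indicator hD _).symm
    _ = c * ∫⁻ a, ∫⁻ b, D.indicator (fun x => ‖f x‖ₑ ^ 2) (L (a, b)) :=
        hL _ ((hf.continuous.enorm.measurable.pow_const 2).indicator hD)
    _ ≤ c * ∫⁻ a, ∫⁻ b, B a * A b := by gcongr with a b; exact key a b
    _ = c * ((∫⁻ b, A b) * ∫⁻ a, B a) := by
        simp_rw [lintegral_const_mul _ hAm]
        rw [lintegral_mul_const _ hBm, mul_comm (∫⁻ a, B a)]
    -- The change of variables costs one factor `c` on the left and two on the right, which is why
    -- the final constant is `c⁻¹`.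
    _ = c⁻¹ * ((c * ∫⁻ b, A b) * (c * ∫⁻ a, B a)) := by
        rw [show c⁻¹ * ((c * ∫⁻ b, A b) * (c * ∫⁻ a, B a))
          = (c⁻¹ * c) * (c * ((∫⁻ b, A b) * ∫⁻ a, B a)) by ring,
          ENNReal.inv_mul_cancel hc0 hc, one_mul]
    _ = _ := by rw [e1, e2]

theorem sq_lintegral_mul_le {X : Type*} [MeasurableSpace X] {ν : Measure X} {f g : X → ℝ≥0∞}
    (hf : AEMeasurable f ν) (hg : AEMeasurable g ν) :
    (∫⁻ x, f x * g x ∂ν) ^ 2 ≤ (∫⁻ x, f x ^ 2 ∂ν) * ∫⁻ x, g x ^ 2 ∂ν := by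
  have h := ENNReal.lintegral_mul_le_Lp_mul_Lq ν Real.HolderConjugate.two_two hf hg
  simp only [Pi.mul_apply, ENNReal.rpow_two] at h
  calc (∫⁻ x, f x * g x ∂ν) ^ 2
      ≤ ((∫⁻ x, f x ^ 2 ∂ν) ^ (1 / 2 : ℝ) * (∫⁻ x, g x ^ 2 ∂ν) ^ (1 / 2 : ℝ)) ^ 2 := by gcongr
    _ = _ := by
        rw [mul_pow, ← ENNReal.rpow_mul_natCast, ← ENNReal.rpow_mul_natCast]
        norm_num

/-- `W^{1,2} ⊆ L^{2 (k + 1)}` on cone-stable sets. -/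
theorem exists_lintegral_pow_le (L : (ℝ × ℝ) ≃L[ℝ] E2) {M N : ℝ≥0∞} (hM : M ≠ ⊤) (hN : N ≠ ⊤)
    (k : ℕ) :
    ∃ C : ℝ≥0∞, C ≠ ⊤ ∧ ∀ (D : Set E2), MeasurableSet D → ∀ f : E2 → ℝ, ContDiff ℝ 1 f →
      HasCompactSupport f →
      (∀ x ∈ D, ∀ a b : ℝ, 0 ≤ a → 0 ≤ b → x + L (a, b) ∈ tsupport f → x + L (a, b) ∈ D) →
      ∫⁻ x in D, ‖f x‖ₑ ^ 2 ≤ M →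
      ∫⁻ x in D, ‖fderiv ℝ f x (L (1, 0))‖ₑ ^ 2 ≤ N →
      ∫⁻ x in D, ‖fderiv ℝ f x (L (0, 1))‖ₑ ^ 2 ≤ N →
      ∫⁻ x in D, ‖f x‖ₑ ^ (2 * (k + 1)) ≤ C := by
  obtain ⟨c, hc, hcD⟩ := exists_lintegral_sq_le L
  induction k with
  | zero => exact ⟨M, hM, fun D hD f hf hfc hcone hfM _ _ => by simpa using hfM⟩
  | succ k ih =>
    obtain ⟨C, hC, hCD⟩ := ih
    -- The `W^{1,1} ⊆ L²` inequality is applied to `f ^ (k + 2)`: its derivative is `(k + 2) f ^ (k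
    -- + 1) ∂f`, and Cauchy–Schwarz with the induction bound `C` and the derivative bound `N`
    -- controls the square of its integral. The constant depends on neither `D` nor `f`, as the
    -- passage to the limit in the mollification requires.
    refine ⟨c * (((k + 2 : ℕ) : ℝ≥0∞) ^ 2 * (C * N)), by finiteness,
      fun D hD f hf hfc hcone hfM hf1 hf2 => ?_⟩
    have hCf := hCD D hD f hf hfc hcone hfM hf1 hf2
    have hpow : HasCompactSupport (fun x => f x ^ (k + 2)) :=
      hfc.comp_left (g := fun y : ℝ => y ^ (k + 2)) (by simp)
    have hts : tsupport (fun x => f x ^ (k + 2)) ⊆ tsupport f :=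
      closure_mono fun x hx h => hx (by simp [h])
    have hstep (v : E2) (hv : ∫⁻ x in D, ‖fderiv ℝ f x v‖ₑ ^ 2 ≤ N) :
        (∫⁻ x in D, ‖fderiv ℝ (fun x => f x ^ (k + 2)) x v‖ₑ) ^ 2
          ≤ ((k + 2 : ℕ) : ℝ≥0∞) ^ 2 * (C * N) := by
      have h1 (x : E2) : ‖fderiv ℝ (fun x => f x ^ (k + 2)) x v‖ₑ
          = ((k + 2 : ℕ) : ℝ≥0∞) * (‖f x‖ₑ ^ (k + 1) * ‖fderiv ℝ f x v‖ₑ) := by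
        rw [fderiv_fun_pow _ (hf.differentiable one_ne_zero x)]
        simp only [smul_apply, smul_eq_mul, enorm_mul, enorm_pow,
          nsmul_eq_mul, Real.enorm_natCast]
        rw [mul_assoc]
        congr 1
      have hm1 : Measurable fun x => ‖f x‖ₑ ^ (k + 1) :=
        hf.continuous.enorm.measurable.pow_const _
      have hm2 : Measurable fun x => ‖fderiv ℝ f x v‖ₑ :=
        ((hf.continuous_fderiv one_ne_zero).clm_apply continuous_const).enorm.measurable
      simp_rw [h1]
      rw [lintegral_const_mul' _ _ (ENNReal.natCast_ne_top _), mul_pow]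
      gcongr
      refine (sq_lintegral_mul_le hm1.aemeasurable hm2.aemeasurable).trans ?_
      refine mul_le_mul' ?_ hv
      simpa only [← pow_mul, mul_comm (k + 1) 2] using hCf
    have hmain := hcD D hD _ (hf.pow (k + 2)) hpow
      fun x hx a b ha hb h => hcone x hx a b ha hb (hts h)
    calc ∫⁻ x in D, ‖f x‖ₑ ^ (2 * (k + 1 + 1))
        = ∫⁻ x in D, ‖f x ^ (k + 2)‖ₑ ^ 2 := by
          refine lintegral_congr fun x => ?_
          rw [enorm_pow, ← pow_mul, mul_comm]
      _ ≤ _ := hmain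
      _ ≤ _ := by
          refine mul_le_mul' le_rfl ?_
          have h1 := hstep _ hf1
          have h2 := hstep _ hf2
          -- A product of two integrals is at most the square of the larger one.
          rcases le_total (∫⁻ x in D, ‖fderiv ℝ (fun x => f x ^ (k + 2)) x (L (1, 0))‖ₑ)
            (∫⁻ x in D, ‖fderiv ℝ (fun x => f x ^ (k + 2)) x (L (0, 1))‖ₑ) with h | h
          · exact (mul_le_mul' h le_rfl).trans ((sq _).symm.trans_le h2)
          · exact (mul_le_mul' le_rfl h).trans ((sq _).symm.trans_le h1)

/-! ### Mollification -/

/-- The convolution `φ ⋆ F`. -/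
def mollify (φ F : E2 → ℝ) (x : E2) : ℝ := ∫ y, φ (x - y) * F y

open scoped Convolution in
theorem mollify_eq_convolution (φ F : E2 → ℝ) :
    mollify φ F = φ ⋆[ContinuousLinearMap.lsmul ℝ ℝ, volume] F := by
  funext x
  rw [convolution_lsmul_swap]
  rfl

theorem contDiff_mollify {φ F : E2 → ℝ} (hφ : IsTestFunction φ) (hF : LocallyIntegrable F) :
    ContDiff ℝ 1 (mollify φ F) := by
  rw [mollify_eq_convolution]
  exact hφ.2.contDiff_convolution_left (n := 1) _ (hφ.1.of_le (by simp)) hF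

theorem fderiv_mollify {φ F : E2 → ℝ} (hφ : IsTestFunction φ) (hF : LocallyIntegrable F)
    (x v : E2) : fderiv ℝ (mollify φ F) x v = mollify (fun y => fderiv ℝ φ y v) F x := by
  have h1 : ContDiff ℝ 1 φ := hφ.1.of_le (by simp)
  rw [mollify_eq_convolution, mollify_eq_convolution,
    (hφ.2.hasFDerivAt_convolution_left (ContinuousLinearMap.lsmul ℝ ℝ) h1 hF x).fderiv]
  have := (hφ.2.fderiv ℝ).convolutionExists_left
    ((ContinuousLinearMap.lsmul ℝ ℝ : ℝ →L[ℝ] ℝ →L[ℝ] ℝ).precompL E2)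
    (h1.continuous_fderiv one_ne_zero) hF x
  simp_rw [convolution_def, ContinuousLinearMap.integral_apply this]
  rfl

/-- Cauchy–Schwarz for the probability measure `φ dy` bounds the square pointwise; Tonelli and
translation invariance then remove the kernel. -/
theorem lintegral_mollify_sq_le {φ F : E2 → ℝ} (hφ : IsTestFunction φ) (hφ0 : 0 ≤ φ)
    (hφ1 : ∫ y, φ y = 1) (hF : Measurable F) :
    ∫⁻ x, ‖mollify φ F x‖ₑ ^ 2 ≤ ∫⁻ x, ‖F x‖ₑ ^ 2 := by
  have hφm : Measurable fun y => ENNReal.ofReal (φ y) := hφ.1.continuous.measurable.ennreal_ofReal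
  have hφ1' : ∫⁻ y, ENNReal.ofReal (φ y) = 1 := by
    rw [← ofReal_integral_eq_lintegral_ofReal
      (hφ.1.continuous.integrable_of_hasCompactSupport hφ.2) (Filter.Eventually.of_forall hφ0),
      hφ1, ENNReal.ofReal_one]
  set ν : Measure E2 := volume.withDensity fun y => ENNReal.ofReal (φ y) with hν
  have hν1 : ν univ = 1 := by rw [hν, withDensity_apply _ MeasurableSet.univ, setLIntegral_univ, hφ1']
  have hshift (x : E2) : Measurable fun t => ‖F (x - t)‖ₑ :=
    (hF.comp (measurable_const.sub measurable_id)).enorm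
  have hpt (x : E2) : ‖mollify φ F x‖ₑ ^ 2 ≤ ∫⁻ t, ENNReal.ofReal (φ t) * ‖F (x - t)‖ₑ ^ 2 := by
    have h1 : ‖mollify φ F x‖ₑ ≤ ∫⁻ t, ‖F (x - t)‖ₑ * 1 ∂ν := by
      simp only [mul_one]
      rw [hν, lintegral_withDensity_eq_lintegral_mul _ hφm (hshift x)]
      have : mollify φ F x = ∫ t, φ t * F (x - t) := by
        rw [mollify, ← integral_sub_left_eq_self _ volume x]
        simp
      rw [this]
      refine (enorm_integral_le_lintegral_enorm _).trans (lintegral_mono fun t => ?_)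
      simp only [Pi.mul_apply, enorm_mul]
      rw [Real.enorm_of_nonneg (hφ0 t)]
    calc ‖mollify φ F x‖ₑ ^ 2 ≤ (∫⁻ t, ‖F (x - t)‖ₑ * 1 ∂ν) ^ 2 := by gcongr
      _ ≤ (∫⁻ t, ‖F (x - t)‖ₑ ^ 2 ∂ν) * ∫⁻ t, 1 ^ 2 ∂ν :=
          sq_lintegral_mul_le (hshift x).aemeasurable aemeasurable_const
      _ = ∫⁻ t, ‖F (x - t)‖ₑ ^ 2 ∂ν := by simp [hν1]
      _ = _ := lintegral_withDensity_eq_lintegral_mul _ hφm ((hshift x).pow_const 2)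
  calc ∫⁻ x, ‖mollify φ F x‖ₑ ^ 2
      ≤ ∫⁻ x, ∫⁻ t, ENNReal.ofReal (φ t) * ‖F (x - t)‖ₑ ^ 2 := lintegral_mono hpt
    _ = ∫⁻ t, ∫⁻ x, ENNReal.ofReal (φ t) * ‖F (x - t)‖ₑ ^ 2 := by
        refine lintegral_lintegral_swap ?_
        exact ((hφm.comp measurable_snd).mul
          ((hF.comp (measurable_fst.sub measurable_snd)).enorm.pow_const 2)).aemeasurable
    _ = ∫⁻ t, ENNReal.ofReal (φ t) * ∫⁻ x, ‖F x‖ₑ ^ 2 := by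
        refine lintegral_congr fun t => ?_
        rw [lintegral_const_mul' _ _ ENNReal.ofReal_ne_top,
          lintegral_sub_right_eq_self (fun x => ‖F x‖ₑ ^ 2) t]
    _ = _ := by rw [lintegral_mul_const _ hφm, hφ1', one_mul]

theorem isTestFunction_normed {c : E2} (b : ContDiffBump c) : IsTestFunction (b.normed volume) :=
  ⟨b.contDiff_normed, b.hasCompactSupport_normed⟩

/-- Mollification with bumps whose centers `-c n` tend to `0` at the rate of their radii. -/
theorem ae_tendsto_mollify {F : E2 → ℝ} (hF : LocallyIntegrable F) {c : ℕ → E2}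
    (b : ∀ n, ContDiffBump (-c n)) {K : ℝ} (hc : ∀ n, ‖c n‖ ≤ K * (b n).rOut)
    (hb : ∀ n, (b n).rOut ≤ 2 * (b n).rIn)
    (hlim : Filter.Tendsto (fun n => (b n).rOut) Filter.atTop (nhds 0)) :
    ∀ᵐ x, Filter.Tendsto (fun n => mollify ((b n).normed volume) F x) Filter.atTop
      (nhds (F x)) := by
  have hlim' : Filter.Tendsto (fun n => (b n).rOut) Filter.atTop (nhdsWithin 0 (Ioi 0)) :=
    tendsto_nhdsWithin_iff.2 ⟨hlim, Filter.Eventually.of_forall fun n => (b n).rOut_pos⟩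
  filter_upwards [IsUnifLocDoublingMeasure.ae_tendsto_average_norm_sub volume hF K] with x hx
  -- The kernel `y ↦ φₙ(x - y)` lives in the ball about `x + c n`, which need not be centred at `x`;
  -- Lebesgue differentiation allows this since `x` stays within `K` radii of the centre.
  have h0 := hx (fun n => x + c n) (fun n => (b n).rOut) hlim'
    (Filter.Eventually.of_forall fun n => by simpa [dist_eq_norm] using hc n)
  refine tendsto_integral_smul_of_tendsto_average_norm_sub (2 ^ (Module.finrank ℝ E2)) h0
    (g := fun n y => (b n).normed volume (x - y)) ?_ ?_ ?_ ?_
  · exact Filter.Eventually.of_forall fun n => hF.integrableOn_isCompact (isCompact_closedBall _ _)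
  · refine tendsto_const_nhds.congr fun n => ?_
    rw [integral_sub_left_eq_self, (b n).integral_normed]
  · refine Filter.Eventually.of_forall fun n y hy => ?_
    have : x - y ∈ Function.support ((b n).normed volume) := hy
    rw [(b n).support_normed_eq, Metric.mem_ball, dist_eq_norm] at this
    rw [Metric.mem_closedBall, dist_eq_norm, ← norm_neg]
    refine le_trans (le_of_eq ?_) this.le
    congr 1
    abel
  · refine Filter.Eventually.of_forall fun n y => ?_
    rw [abs_of_nonneg ((b n).nonneg_normed _), Measure.addHaar_real_closedBall_center,
      ← Measure.addHaar_real_closedBall_center volume (-c n)]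
    exact (b n).normed_le_div_measure_closedBall_rOut _ _ (hb n) _

theorem support_mollify_subset {c : E2} (b : ContDiffBump (-c)) {F : E2 → ℝ} {T : Set E2}
    (hT : Function.support F ⊆ T) {ε : ℝ} (hε : ‖c‖ + b.rOut ≤ ε) :
    Function.support (mollify (b.normed volume) F) ⊆ Metric.cthickening ε T := by
  intro x hx
  rw [mollify_eq_convolution] at hx
  obtain ⟨y, hy, y', hy', rfl⟩ := mem_add.1 (support_convolution_subset _ hx)
  rw [b.support_normed_eq, Metric.mem_ball, dist_eq_norm] at hy
  refine Metric.mem_cthickening_of_dist_le _ y' _ _ (hT hy') ?_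
  rw [dist_eq_norm, add_sub_cancel_right]
  calc ‖y‖ = ‖(y - -c) - c‖ := by congr 1; abel
    _ ≤ ‖y - -c‖ + ‖c‖ := norm_sub_le _ _
    _ ≤ ε := by linarith

/-! ### The Sobolev embedding near a point of `Ω` -/

theorem eLpNorm_natCast_lt_top_iff {X : Type*} [MeasurableSpace X] {ν : Measure X} {H : Type*}
    [NormedAddCommGroup H] {f : X → H} {n : ℕ} (hn : n ≠ 0) :
    eLpNorm f n ν < ⊤ ↔ ∫⁻ x, ‖f x‖ₑ ^ n ∂ν < ⊤ := by
  rw [eLpNorm_lt_top_iff_lintegral_rpow_enorm_lt_top (by exact_mod_cast hn)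
    (ENNReal.natCast_ne_top n)]
  simp

/-- The derivative in direction `v` of a pair. -/
def dirDeriv {G : Geometry} (w : FieldPair ℝ G 2) (v : E2) (x : E2) : ℝ :=
  v 0 * w.snd x 0 + v 1 * w.snd x 1

theorem measurable_fst {G : Geometry} (w : FieldPair ℝ G 2) : Measurable fun x => w.fst x :=
  (Lp.stronglyMeasurable w.fst).measurable

theorem measurable_snd {G : Geometry} (w : FieldPair ℝ G 2) (i : Fin 2) :
    Measurable fun x => w.snd x i :=
  (PiLp.continuous_apply 2 (fun _ : Fin 2 => ℝ) i).measurable.comp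
    (Lp.stronglyMeasurable w.snd).measurable

theorem measurable_dirDeriv {G : Geometry} (w : FieldPair ℝ G 2) (v : E2) :
    Measurable (dirDeriv w v) :=
  ((measurable_snd w 0).const_mul _).add ((measurable_snd w 1).const_mul _)

theorem memLp_dirDeriv {G : Geometry} (w : FieldPair ℝ G 2) (v : E2) :
    MemLp (dirDeriv w v) 2 G.μ := by
  have h (i : Fin 2) : MemLp (fun x => w.snd x i) 2 G.μ :=
    (PiLp.proj 2 (fun _ : Fin 2 => ℝ) i : _ →L[ℝ] ℝ).comp_memLp' (Lp.memLp w.snd)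
  exact ((h 0).const_mul _).add ((h 1).const_mul _)

theorem MemLp.mul_continuous {G : Geometry} {χ : E2 → ℝ} (hχ : Continuous χ)
    (hc : HasCompactSupport χ) {f : E2 → ℝ} (hf : MemLp f 2 G.μ) :
    MemLp (fun x => χ x * f x) 2 G.μ := by
  obtain ⟨C, hC⟩ := hc.exists_bound_of_continuous hχ
  exact hf.mul (p := ⊤) (memLp_top_of_bound hχ.aestronglyMeasurable C
    (Filter.Eventually.of_forall hC))

theorem IsTestFunction.continuous_fderiv_apply {φ : E2 → ℝ} (hφ : IsTestFunction φ) (v : E2) :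
    Continuous fun x => fderiv ℝ φ x v :=
  (hφ.1.continuous_fderiv (by simp)).clm_apply continuous_const

theorem IsTestFunction.hasCompactSupport_fderiv_apply {φ : E2 → ℝ} (hφ : IsTestFunction φ)
    (v : E2) : HasCompactSupport fun x => fderiv ℝ φ x v :=
  hφ.2.fderiv_apply ℝ v

theorem fderiv_apply_eq_partialDeriv (φ : E2 → ℝ) (x v : E2) :
    fderiv ℝ φ x v = v 0 * partialDeriv 0 φ x + v 1 * partialDeriv 1 φ x := by
  have hv : v = v 0 • EuclideanSpace.single 0 1 + v 1 • EuclideanSpace.single 1 1 := by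
    ext i
    fin_cases i <;> simp
  conv_lhs => rw [hv]
  simp [partialDeriv]

theorem integral_fderiv_mul_add {G : Geometry} {w : FieldPair ℝ G 2} (hw : w ∈ sobolev ℝ G 2)
    {ψ : E2 → ℝ} (hψ : IsTestFunction ψ) (hs : tsupport ψ ⊆ G.Ω) (v : E2) :
    (∫ x, fderiv ℝ ψ x v * w.fst x ∂G.μ) + ∫ x, ψ x * dirDeriv w v x ∂G.μ = 0 := by
  have hi (i : Fin 2) : Integrable (fun x => partialDeriv i ψ x * w.fst x) G.μ :=
    integrable_smul (hψ.continuous_partialDeriv i) (hψ.hasCompactSupport_partialDeriv i)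
      (integrable_fst w)
  have hj (i : Fin 2) : Integrable (fun x => ψ x * w.snd x i) G.μ :=
    integrable_smul hψ.1.continuous hψ.2 (integrable_snd w i)
  have h (i : Fin 2) :
      (∫ x, partialDeriv i ψ x * w.fst x ∂G.μ) + ∫ x, ψ x * w.snd x i ∂G.μ = 0 := hw i ψ hψ hs
  have e1 : ∫ x, fderiv ℝ ψ x v * w.fst x ∂G.μ
      = v 0 * (∫ x, partialDeriv 0 ψ x * w.fst x ∂G.μ)
        + v 1 * ∫ x, partialDeriv 1 ψ x * w.fst x ∂G.μ := by
    rw [← integral_const_mul, ← integral_const_mul,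
      ← integral_add ((hi 0).const_mul _) ((hi 1).const_mul _)]
    refine integral_congr_ae (Filter.Eventually.of_forall fun x => ?_)
    simp only [fderiv_apply_eq_partialDeriv ψ x v]
    ring
  have e2 : ∫ x, ψ x * dirDeriv w v x ∂G.μ
      = v 0 * (∫ x, ψ x * w.snd x 0 ∂G.μ) + v 1 * ∫ x, ψ x * w.snd x 1 ∂G.μ := by
    rw [← integral_const_mul, ← integral_const_mul,
      ← integral_add ((hj 0).const_mul _) ((hj 1).const_mul _)]
    refine integral_congr_ae (Filter.Eventually.of_forall fun x => ?_)
    simp only [dirDeriv]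
    ring
  rw [e1, e2]
  linear_combination v 0 * h 0 + v 1 * h 1

/-- The function `χ u`, extended by zero. -/
def cutoff {G : Geometry} (w : FieldPair ℝ G 2) (χ : E2 → ℝ) : E2 → ℝ :=
  G.Ω.indicator fun x => χ x * w.fst x

/-- The weak derivative of `χ u` in direction `v`, extended by zero. -/
def cutoffDeriv {G : Geometry} (w : FieldPair ℝ G 2) (χ : E2 → ℝ) (v : E2) : E2 → ℝ :=
  G.Ω.indicator fun x => χ x * dirDeriv w v x + fderiv ℝ χ x v * w.fst x

theorem measurable_cutoff {G : Geometry} (w : FieldPair ℝ G 2) {χ : E2 → ℝ}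
    (hχ : IsTestFunction χ) : Measurable (cutoff w χ) :=
  (hχ.1.continuous.measurable.mul (measurable_fst w)).indicator G.isOpen.measurableSet

theorem measurable_cutoffDeriv {G : Geometry} (w : FieldPair ℝ G 2) {χ : E2 → ℝ}
    (hχ : IsTestFunction χ) (v : E2) : Measurable (cutoffDeriv w χ v) :=
  ((hχ.1.continuous.measurable.mul (measurable_dirDeriv w v)).add
    ((hχ.continuous_fderiv_apply v).measurable.mul (measurable_fst w))).indicator
      G.isOpen.measurableSet

theorem lintegral_indicator_sq_lt_top {G : Geometry} {f : E2 → ℝ} (hf : MemLp f 2 G.μ) :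
    ∫⁻ x, ‖G.Ω.indicator f x‖ₑ ^ 2 < ⊤ := by
  have h := (memLp_indicator_iff_restrict G.isOpen.measurableSet).2 hf
  exact (eLpNorm_natCast_lt_top_iff two_ne_zero).1 (by exact_mod_cast h.2)

theorem lintegral_cutoff_sq_lt_top {G : Geometry} (w : FieldPair ℝ G 2) {χ : E2 → ℝ}
    (hχ : IsTestFunction χ) : ∫⁻ x, ‖cutoff w χ x‖ₑ ^ 2 < ⊤ :=
  lintegral_indicator_sq_lt_top (MemLp.mul_continuous hχ.1.continuous hχ.2 (Lp.memLp w.fst))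

theorem lintegral_cutoffDeriv_sq_lt_top {G : Geometry} (w : FieldPair ℝ G 2) {χ : E2 → ℝ}
    (hχ : IsTestFunction χ) (v : E2) : ∫⁻ x, ‖cutoffDeriv w χ v x‖ₑ ^ 2 < ⊤ :=
  lintegral_indicator_sq_lt_top <|
    (MemLp.mul_continuous hχ.1.continuous hχ.2 (memLp_dirDeriv w v)).add
      (MemLp.mul_continuous (hχ.continuous_fderiv_apply v) (hχ.hasCompactSupport_fderiv_apply v)
        (Lp.memLp w.fst))

theorem integrable_cutoff {G : Geometry} (w : FieldPair ℝ G 2) {χ : E2 → ℝ}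
    (hχ : IsTestFunction χ) : Integrable (cutoff w χ) :=
  (integrable_indicator_iff G.isOpen.measurableSet).2
    (integrable_smul hχ.1.continuous hχ.2 (integrable_fst w))

theorem integral_mul_indicator {G : Geometry} (a h : E2 → ℝ) :
    ∫ y, a y * G.Ω.indicator h y = ∫ y, a y * h y ∂G.μ := by
  rw [Geometry.μ, ← integral_indicator G.isOpen.measurableSet]
  refine integral_congr_ae (Filter.Eventually.of_forall fun y => ?_)
  by_cases hy : y ∈ G.Ω <;> simp [hy]

/-- A cone of directions, spanned by `L (1, 0)` and `L (0, 1)`, that can be used to move inside `Ω`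
as long as `B` is not left. -/
def ConeStable (Ω B : Set E2) (L : (ℝ × ℝ) ≃L[ℝ] E2) : Prop :=
  ∀ x ∈ Ω ∩ B, ∀ a b : ℝ, 0 ≤ a → 0 ≤ b → x + L (a, b) ∈ B → x + L (a, b) ∈ Ω

/-- The zero extension of `χ u` may jump across `∂Ω`, so this fails for general kernels. Here `y ↦
φ(x - y) χ(y)` is supported in `x` plus the cone and in `B`, hence in `Ω`, and is admissible in the
definition of the weak gradient without a boundary term. -/
theorem mollify_fderiv_cutoff {G : Geometry} {w : FieldPair ℝ G 2} (hw : w ∈ sobolev ℝ G 2)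
    {L : (ℝ × ℝ) ≃L[ℝ] E2} {B : Set E2} (hcone : ConeStable G.Ω B L)
    {χ φ : E2 → ℝ} (hχ : IsTestFunction χ) (hφ : IsTestFunction φ) (hχB : tsupport χ ⊆ B)
    (hφL : ∀ y ∈ tsupport φ, ∃ a b : ℝ, 0 ≤ a ∧ 0 ≤ b ∧ -y = L (a, b))
    {x : E2} (hx : x ∈ G.Ω ∩ B) (v : E2) :
    mollify (fun y => fderiv ℝ φ y v) (cutoff w χ) x = mollify φ (cutoffDeriv w χ v) x := by
  set ρ : E2 → ℝ := fun y => φ (x - y) with hρ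
  have hρd : ContDiff ℝ ((⊤ : ℕ∞) : WithTop ℕ∞) ρ := hφ.1.comp (contDiff_const.sub contDiff_id)
  have hψ : IsTestFunction fun y => ρ y * χ y := ⟨hρd.mul hχ.1, hχ.2.mul_left⟩
  have hdρ (y : E2) : fderiv ℝ ρ y v = -fderiv ℝ φ (x - y) v := by
    have h1 : HasFDerivAt (fun y : E2 => x - y) (-ContinuousLinearMap.id ℝ E2) y :=
      (hasFDerivAt_id y).const_sub x
    have := ((hφ.1.differentiable (by simp) (x - y)).hasFDerivAt.comp y h1).fderiv
    change fderiv ℝ (φ ∘ fun y => x - y) y v = _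
    rw [this]
    simp
  have hdψ (y : E2) : fderiv ℝ (fun y => ρ y * χ y) y v
      = ρ y * fderiv ℝ χ y v - fderiv ℝ φ (x - y) v * χ y := by
    rw [fderiv_fun_mul (hρd.differentiable (by simp) y) (hχ.1.differentiable (by simp) y)]
    simp only [add_apply, smul_apply, smul_eq_mul, hdρ]
    ring
  have hsupp : tsupport (fun y => ρ y * χ y) ⊆ G.Ω := by
    intro y hy
    have hyχ : y ∈ tsupport χ := closure_mono (Function.support_mul_subset_right ρ χ) hy
    have hyρ : x - y ∈ tsupport φ := by
      have h1 : y ∈ closure (Function.support ρ) :=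
        closure_mono (Function.support_mul_subset_left ρ χ) hy
      have h2 : IsClosed ((fun y => x - y) ⁻¹' tsupport φ) :=
        (isClosed_tsupport φ).preimage (continuous_const.sub continuous_id)
      have h3 : Function.support ρ ⊆ (fun y => x - y) ⁻¹' tsupport φ :=
        fun z hz => subset_tsupport φ hz
      exact closure_minimal h3 h2 h1
    obtain ⟨a, b, ha, hb, hab⟩ := hφL _ hyρ
    have hyx : y = x + L (a, b) := by rw [← hab]; abel
    rw [hyx]
    exact hcone x hx a b ha hb (hyx ▸ hχB hyχ)
  have hgreen := integral_fderiv_mul_add hw hψ hsupp v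
  have hf := integrable_fst w
  have hg : Integrable (dirDeriv w v) G.μ := (memLp_dirDeriv w v).integrable (by norm_num)
  have i1 : Integrable (fun y => fderiv ℝ φ (x - y) v * χ y * w.fst y) G.μ :=
    integrable_smul (((hφ.continuous_fderiv_apply v).comp (continuous_const.sub continuous_id)).mul
      hχ.1.continuous) hχ.2.mul_left hf
  have i2 : Integrable (fun y => ρ y * fderiv ℝ χ y v * w.fst y) G.μ :=
    integrable_smul (hρd.continuous.mul (hχ.continuous_fderiv_apply v))
      (hχ.hasCompactSupport_fderiv_apply v).mul_left hf
  have i3 : Integrable (fun y => ρ y * χ y * dirDeriv w v y) G.μ :=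
    integrable_smul hψ.1.continuous hψ.2 hg
  have e1 : mollify (fun y => fderiv ℝ φ y v) (cutoff w χ) x
      = ∫ y, fderiv ℝ φ (x - y) v * χ y * w.fst y ∂G.μ := by
    rw [mollify, cutoff, integral_mul_indicator]
    simp only [mul_assoc]
  have e2 : mollify φ (cutoffDeriv w χ v) x
      = (∫ y, ρ y * χ y * dirDeriv w v y ∂G.μ) + ∫ y, ρ y * fderiv ℝ χ y v * w.fst y ∂G.μ := by
    rw [mollify, cutoffDeriv, integral_mul_indicator, ← integral_add i3 i2]
    refine integral_congr_ae (Filter.Eventually.of_forall fun y => ?_)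
    simp only [hρ]
    ring
  have e3 : ∫ y, fderiv ℝ (fun y => ρ y * χ y) y v * w.fst y ∂G.μ
      = (∫ y, ρ y * fderiv ℝ χ y v * w.fst y ∂G.μ)
        - ∫ y, fderiv ℝ φ (x - y) v * χ y * w.fst y ∂G.μ := by
    rw [← integral_sub i2 i1]
    refine integral_congr_ae (Filter.Eventually.of_forall fun y => ?_)
    simp only [hdψ]
    ring
  rw [e3] at hgreen
  rw [e1, e2]
  linarith

/-- The uniform estimate for cone-stable sets is applied on `D = Ω ∩ B` to shifted mollifications of
the cut-off function; these converge a.e., and Fatou's lemma transfers the bound. -/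
theorem lintegral_cutoff_pow_lt_top {G : Geometry} {w : FieldPair ℝ G 2} (hw : w ∈ sobolev ℝ G 2)
    {L : (ℝ × ℝ) ≃L[ℝ] E2} {B : Set E2} (hB : IsOpen B) (hcone : ConeStable G.Ω B L)
    {χ : E2 → ℝ} (hχ : IsTestFunction χ) (hχB : tsupport χ ⊆ B) (k : ℕ) :
    ∫⁻ x in G.Ω ∩ B, ‖χ x * w.fst x‖ₑ ^ (2 * (k + 1)) < ⊤ := by
  obtain ⟨ε, hε, hεB⟩ := hχ.2.isCompact.exists_cthickening_subset_open hB hχB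
  set m : ℝ := ‖(L.symm : E2 →L[ℝ] ℝ × ℝ)‖ with hm
  set K : ℝ := m * ‖L (1, 1)‖ with hK
  have hK0 : 0 ≤ K := by positivity
  -- The radii satisfy `(K + 1) r n ≤ ε`, so shift plus radius is at most `ε` and the mollified
  -- functions remain supported in `B`.
  set r : ℕ → ℝ := fun n => ε / ((K + 1) * (n + 1)) with hr
  have hr0 (n : ℕ) : 0 < r n := by positivity
  set c : ℕ → E2 := fun n => (m * r n) • L (1, 1) with hc
  have hcn (n : ℕ) : ‖c n‖ = K * r n := by
    rw [hc, norm_smul, Real.norm_of_nonneg (mul_nonneg (norm_nonneg _) (hr0 n).le), hK]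
    ring
  set b : ∀ n, ContDiffBump (-c n) := fun n => ⟨r n / 2, r n, half_pos (hr0 n), half_lt_self (hr0 n)⟩
    with hb
  set f : ℕ → E2 → ℝ := fun n => mollify ((b n).normed volume) (cutoff w χ) with hf
  have hF := integrable_cutoff w hχ
  have hloc : LocallyIntegrable (cutoff w χ) := hF.locallyIntegrable
  have hsuppF : Function.support (cutoff w χ) ⊆ tsupport χ := fun x hx => by
    refine subset_tsupport χ fun h => hx ?_
    by_cases hxΩ : x ∈ G.Ω <;> simp [cutoff, hxΩ, h]
  have hts (n : ℕ) : tsupport (f n) ⊆ Metric.cthickening ε (tsupport χ) := by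
    refine closure_minimal (support_mollify_subset (b n) hsuppF ?_) Metric.isClosed_cthickening
    rw [hcn]
    have : r n ≤ ε / (K + 1) := by
      rw [hr]
      refine div_le_div_of_nonneg_left hε.le (by positivity) ?_
      nlinarith [(Nat.cast_nonneg n : (0 : ℝ) ≤ n)]
    rw [le_div_iff₀ (by positivity)] at this
    change K * r n + r n ≤ ε
    linarith
  -- Under `y ↦ -L⁻¹ y` the ball of radius `r n` about `-c n` lands within sup-distance `m * r n` of
  -- `(m * r n, m * r n)`, hence in the closed positive quadrant.
  have hφL (n : ℕ) : ∀ y ∈ tsupport ((b n).normed volume),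
      ∃ a d : ℝ, 0 ≤ a ∧ 0 ≤ d ∧ -y = L (a, d) := by
    intro y hy
    rw [(b n).tsupport_normed_eq, Metric.mem_closedBall, dist_eq_norm] at hy
    have h1 : ‖L.symm (-y) - (m * r n, m * r n)‖ ≤ m * r n := by
      have : L.symm (-y) - (m * r n, m * r n) = -L.symm (y - -c n) := by
        have h2 : L.symm (c n) = (m * r n, m * r n) := by simp [hc]
        rw [sub_neg_eq_add, map_add, h2, map_neg]
        abel
      rw [this, norm_neg]
      exact (L.symm : E2 →L[ℝ] ℝ × ℝ).le_of_opNorm_le_of_le le_rfl hy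
    have h3 := (norm_fst_le _).trans h1
    have h4 := (norm_snd_le _).trans h1
    simp only [Prod.fst_sub, Prod.snd_sub, Real.norm_eq_abs] at h3 h4
    refine ⟨(L.symm (-y)).1, (L.symm (-y)).2, ?_, ?_, ?_⟩
    · linarith [(abs_le.1 h3).1]
    · linarith [(abs_le.1 h4).1]
    · rw [Prod.mk.eta, L.apply_symm_apply]
  obtain ⟨C, hC, hCf⟩ := exists_lintegral_pow_le L (lintegral_cutoff_sq_lt_top w hχ).ne
    (max_lt (lintegral_cutoffDeriv_sq_lt_top w hχ (L (1, 0)))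
      (lintegral_cutoffDeriv_sq_lt_top w hχ (L (0, 1)))).ne k
  have hD : MeasurableSet (G.Ω ∩ B) := (G.isOpen.inter hB).measurableSet
  have htest (n : ℕ) := isTestFunction_normed (b n)
  have hder (n : ℕ) (v : E2) : ∫⁻ x in G.Ω ∩ B, ‖fderiv ℝ (f n) x v‖ₑ ^ 2
      ≤ ∫⁻ x, ‖cutoffDeriv w χ v x‖ₑ ^ 2 := by
    refine le_trans ?_ (lintegral_mollify_sq_le (htest n) (fun y => (b n).nonneg_normed y)
      (b n).integral_normed (measurable_cutoffDeriv w hχ v))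
    -- Derivative and mollification commute only on `Ω ∩ B`; after this replacement the integral may
    -- be enlarged to the plane.
    refine le_trans (setLIntegral_mono' hD fun x hx => ?_) (setLIntegral_le_lintegral (G.Ω ∩ B) _)
    rw [hf, fderiv_mollify (htest n) hloc,
      mollify_fderiv_cutoff hw hcone hχ (htest n) hχB (hφL n) hx]
  have hbound (n : ℕ) : ∫⁻ x in G.Ω ∩ B, ‖f n x‖ₑ ^ (2 * (k + 1)) ≤ C := by
    refine hCf _ hD (f n) (contDiff_mollify (htest n) hloc) ?_ ?_ ?_ ?_ ?_
    · exact HasCompactSupport.of_support_subset_isCompact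
        hχ.2.isCompact.cthickening ((subset_tsupport _).trans (hts n))
    · intro x hx a d ha hd h
      have hxB := hεB (hts n h)
      exact ⟨hcone x hx a d ha hd hxB, hxB⟩
    · exact (setLIntegral_le_lintegral _ _).trans
        (lintegral_mollify_sq_le (htest n) (fun y => (b n).nonneg_normed y)
          (b n).integral_normed (measurable_cutoff w hχ))
    · exact (hder n _).trans (le_max_left _ _)
    · exact (hder n _).trans (le_max_right _ _)
  have hlim : Filter.Tendsto r Filter.atTop (nhds 0) := by
    have h1 : Filter.Tendsto (fun n : ℕ => ε / (K + 1) * (1 / ((n : ℝ) + 1))) Filter.atTop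
        (nhds (ε / (K + 1) * 0)) := tendsto_one_div_add_atTop_nhds_zero_nat.const_mul _
    rw [mul_zero] at h1
    refine h1.congr fun n => ?_
    rw [hr]
    field_simp
  have hae := ae_tendsto_mollify hloc b (K := K) (fun n => (hcn n).le)
    (fun n => by change r n ≤ 2 * (r n / 2); linarith) hlim
  calc ∫⁻ x in G.Ω ∩ B, ‖χ x * w.fst x‖ₑ ^ (2 * (k + 1))
      = ∫⁻ x in G.Ω ∩ B, Filter.liminf (fun n => ‖f n x‖ₑ ^ (2 * (k + 1))) Filter.atTop := by
        refine setLIntegral_congr_fun_ae hD ?_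
        filter_upwards [hae] with x hx hxD
        have h1 : cutoff w χ x = χ x * w.fst x := by simp [cutoff, hxD.1]
        rw [h1] at hx
        exact (((ENNReal.continuous_pow _).tendsto _).comp hx.enorm).liminf_eq.symm
    _ ≤ Filter.liminf (fun n => ∫⁻ x in G.Ω ∩ B, ‖f n x‖ₑ ^ (2 * (k + 1))) Filter.atTop :=
        lintegral_liminf_le fun n =>
          (contDiff_mollify (htest n) hloc).continuous.enorm.measurable.pow_const _
    _ ≤ C := by
        refine Filter.liminf_le_of_le (by isBoundedDefault) fun a ha => ?_
        obtain ⟨n, hn⟩ := ha.exists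
        exact hn.trans (hbound n)
    _ < ⊤ := hC.lt_top

/-! ### The Sobolev embedding on `Ω` -/

/-- The isomorphism `(a, b) ↦ (a - b, κ (a + b))`. -/
def skewEquiv (κ : ℝ) (hκ : κ ≠ 0) : (ℝ × ℝ) ≃L[ℝ] E2 :=
  LinearEquiv.toContinuousLinearEquiv
    { toFun := fun p => !₂[p.1 - p.2, κ * (p.1 + p.2)]
      map_add' := fun p q => by
        ext i
        fin_cases i <;> simp <;> ring
      map_smul' := fun c p => by
        ext i
        fin_cases i <;> simp <;> ring
      invFun := fun y => ((y 1 / κ + y 0) / 2, (y 1 / κ - y 0) / 2)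
      left_inv := fun p => by
        ext <;> simp <;> field_simp <;> ring
      right_inv := fun y => by
        ext i
        fin_cases i <;> simp <;> field_simp <;> ring }

theorem skewEquiv_apply (κ : ℝ) (hκ : κ ≠ 0) (a b : ℝ) :
    skewEquiv κ hκ (a, b) = !₂[a - b, κ * (a + b)] := rfl

/-- At an interior point any ball inside `Ω` works. At a boundary point, a step `(a - b, (K + 1)(a +
b))` in graph coordinates raises the height by `(K + 1)(a + b)`, while the `K`-Lipschitz graph rises
by at most `K |a - b| ≤ K (a + b)`. -/
theorem exists_coneStable (G : Geometry) {x₀ : E2} (hx₀ : x₀ ∈ closure G.Ω) :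
    ∃ (r : ℝ) (L : (ℝ × ℝ) ≃L[ℝ] E2), 0 < r ∧ ConeStable G.Ω (Metric.ball x₀ r) L := by
  by_cases h : x₀ ∈ G.Ω
  · obtain ⟨r, hr, hrΩ⟩ := Metric.isOpen_iff.1 G.isOpen x₀ h
    exact ⟨r, skewEquiv 1 one_ne_zero, hr, fun x _ a b _ _ hB => hrΩ hB⟩
  · have hfr : x₀ ∈ frontier G.Ω := by
      rw [frontier, G.isOpen.interior_eq]
      exact ⟨hx₀, h⟩
    obtain ⟨Φ, r, K, g, hr, hg, hΦ⟩ := G.lipschitz x₀ hfr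
    have hK : (K : ℝ) + 1 ≠ 0 := by positivity
    refine ⟨r, (skewEquiv (K + 1) hK).trans Φ.linearIsometryEquiv.symm.toContinuousLinearEquiv, hr,
      ?_⟩
    intro x hx a b ha hb hB
    rw [hΦ _ hB]
    have hxΩ := (hΦ x hx.2).1 hx.1
    have hadd : Φ (x + ((skewEquiv (K + 1) hK).trans
        Φ.linearIsometryEquiv.symm.toContinuousLinearEquiv) (a, b))
        = Φ x + !₂[a - b, (K + 1) * (a + b)] := by
      rw [add_comm, ← vadd_eq_add, Φ.map_vadd, vadd_eq_add, add_comm]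
      simp [skewEquiv_apply]
    rw [hadd]
    simp only [PiLp.add_apply, Matrix.cons_val_zero, Matrix.cons_val_one, Fin.isValue]
    have h1 := hg.dist_le_mul (Φ x 0 + (a - b)) (Φ x 0)
    rw [Real.dist_eq, Real.dist_eq, add_sub_cancel_left] at h1
    have h2 : |a - b| ≤ a + b := abs_le.2 ⟨by linarith, by linarith⟩
    have h3 : (K : ℝ) * |a - b| ≤ K * (a + b) := mul_le_mul_of_nonneg_left h2 K.2
    have h4 := (abs_le.1 h1).2
    nlinarith

theorem exists_nhds_lintegral_pow_lt_top {G : Geometry} {w : FieldPair ℝ G 2}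
    (hw : w ∈ sobolev ℝ G 2) (k : ℕ) {x₀ : E2} (hx₀ : x₀ ∈ closure G.Ω) :
    ∃ t ∈ nhds x₀, ∫⁻ x in G.Ω ∩ t, ‖w.fst x‖ₑ ^ (2 * (k + 1)) < ⊤ := by
  obtain ⟨r, L, hr, hL⟩ := exists_coneStable G hx₀
  let χ : ContDiffBump x₀ := ⟨r / 4, r / 2, by positivity, by linarith⟩
  have hχ : IsTestFunction χ := ⟨χ.contDiff, χ.hasCompactSupport⟩
  have hχB : tsupport χ ⊆ Metric.ball x₀ r := by
    rw [χ.tsupport_eq]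
    exact Metric.closedBall_subset_ball (by change r / 2 < r; linarith)
  refine ⟨Metric.ball x₀ (r / 4), Metric.ball_mem_nhds _ (by positivity), ?_⟩
  refine lt_of_le_of_lt ?_ (lintegral_cutoff_pow_lt_top hw Metric.isOpen_ball hL hχ hχB k)
  calc ∫⁻ x in G.Ω ∩ Metric.ball x₀ (r / 4), ‖w.fst x‖ₑ ^ (2 * (k + 1))
      = ∫⁻ x in G.Ω ∩ Metric.ball x₀ (r / 4), ‖χ x * w.fst x‖ₑ ^ (2 * (k + 1)) := by
        refine setLIntegral_congr_fun (G.isOpen.inter Metric.isOpen_ball).measurableSet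
          fun x hx => ?_
        rw [χ.one_of_mem_closedBall (Metric.ball_subset_closedBall hx.2), one_mul]
    _ ≤ _ := lintegral_mono_set
        (inter_subset_inter_right _ (Metric.ball_subset_ball (by linarith)))

/-- The Sobolev embedding `H¹(Ω) ⊆ L^{2 (k + 1)}(Ω)`. -/
theorem Z.memLp_fn {G : Geometry} (z : Z G) (k : ℕ) :
    MemLp z.fn ((2 * (k + 1) : ℕ) : ℝ≥0∞) G.μ := by
  refine ⟨Lp.aestronglyMeasurable z.1.fst, (eLpNorm_natCast_lt_top_iff (by positivity)).2 ?_⟩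
  have hcpt : IsCompact (closure G.Ω) := G.isBounded.isCompact_closure
  have h : ∫⁻ x in G.Ω ∩ closure G.Ω, ‖z.1.fst x‖ₑ ^ (2 * (k + 1)) < ⊤ := by
    -- Finiteness of the integral over `Ω ∩ s` passes to subsets and finite unions and holds near
    -- each point of `closure Ω`, boundary points included; compactness makes it global.
    refine hcpt.induction_on (p := fun s => ∫⁻ x in G.Ω ∩ s, ‖z.1.fst x‖ₑ ^ (2 * (k + 1)) < ⊤)
      (by simp) (fun s t hst ht => ?_) (fun s t hs ht => ?_) fun x hx => ?_
    · exact (lintegral_mono_set (inter_subset_inter_right _ hst)).trans_lt ht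
    · rw [inter_union_distrib_left]
      exact (lintegral_union_le _ _ _).trans_lt (ENNReal.add_lt_top.2 ⟨hs, ht⟩)
    · obtain ⟨t, ht, h⟩ := exists_nhds_lintegral_pow_lt_top z.2 k hx
      exact ⟨t, mem_nhdsWithin_of_mem_nhds ht, h⟩
  rwa [inter_eq_left.2 subset_closure] at h

/-! ### Vector valued Sobolev functions on an interval -/

section Interval

open Filter Topology

theorem hasCompactSupport_deriv_smoothTransition :
    HasCompactSupport (deriv Real.smoothTransition) := by
  refine HasCompactSupport.intro (K := Icc 0 1) isCompact_Icc fun x hx => ?_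
  rw [mem_Icc, not_and_or, not_le, not_le] at hx
  rcases hx with hx | hx
  · have : Real.smoothTransition =ᶠ[𝓝 x] fun _ => 0 := by
      filter_upwards [Iio_mem_nhds hx] with y hy
      exact Real.smoothTransition.zero_of_nonpos (le_of_lt hy)
    rw [this.deriv_eq, deriv_const]
  · have : Real.smoothTransition =ᶠ[𝓝 x] fun _ => 1 := by
      filter_upwards [Ioi_mem_nhds hx] with y hy
      exact Real.smoothTransition.one_of_one_le (le_of_lt hy)
    rw [this.deriv_eq, deriv_const]

theorem continuous_deriv_smoothTransition : Continuous (deriv Real.smoothTransition) :=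
  (Real.smoothTransition.contDiff (n := 1)).continuous_deriv (by simp)

theorem integrable_deriv_smoothTransition : Integrable (deriv Real.smoothTransition) :=
  continuous_deriv_smoothTransition.integrable_of_hasCompactSupport
    hasCompactSupport_deriv_smoothTransition

theorem integral_deriv_smoothTransition : ∫ x, deriv Real.smoothTransition x = 1 := by
  have hd (x : ℝ) : HasDerivAt Real.smoothTransition (deriv Real.smoothTransition x) x :=
    ((Real.smoothTransition.contDiff (n := 1)).differentiable (by simp) x).hasDerivAt
  rw [integral_of_hasDerivAt_of_tendsto (m := 0) (n := 1) hd integrable_deriv_smoothTransition]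
  · simp
  · refine tendsto_const_nhds.congr' ?_
    filter_upwards [eventually_le_atBot 0] with x hx
    exact (Real.smoothTransition.zero_of_nonpos hx).symm
  · refine tendsto_const_nhds.congr' ?_
    filter_upwards [eventually_ge_atTop 1] with x hx
    exact (Real.smoothTransition.one_of_one_le hx).symm

variable {X : Type} [NormedAddCommGroup X] [NormedSpace ℝ X]

/-- The smooth step at `a` of width `ε`. -/
def smoothStep (a ε s : ℝ) : ℝ := Real.smoothTransition ((s - a) / ε)

theorem contDiff_smoothStep (a ε : ℝ) :
    ContDiff ℝ ((⊤ : ℕ∞) : WithTop ℕ∞) (smoothStep a ε) :=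
  Real.smoothTransition.contDiff.comp ((contDiff_id.sub contDiff_const).div_const ε)

theorem deriv_smoothStep (a ε s : ℝ) :
    deriv (smoothStep a ε) s = ε⁻¹ * deriv Real.smoothTransition ((s - a) / ε) := by
  have h1 : HasDerivAt (fun s : ℝ => (s - a) / ε) (1 / ε) s :=
    ((hasDerivAt_id s).sub_const a).div_const ε
  have h2 : HasDerivAt Real.smoothTransition (deriv Real.smoothTransition ((s - a) / ε))
      ((s - a) / ε) :=
    ((Real.smoothTransition.contDiff (n := 1)).differentiable (by simp) _).hasDerivAt
  have := (h2.comp s h1).deriv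
  change deriv (Real.smoothTransition ∘ fun s => (s - a) / ε) s = _
  rw [this]
  ring

/-- The derivative of the step is an approximate identity at `a`: substitute `s = a + ε τ` and use
dominated convergence. -/
theorem tendsto_integral_deriv_smoothStep [CompleteSpace X] {f : ℝ → X} (hf : Continuous f)
    {C : ℝ} (hC : ∀ s, ‖f s‖ ≤ C) (a : ℝ) :
    Tendsto (fun ε => ∫ s, deriv (smoothStep a ε) s • f s) (𝓝[>] 0) (𝓝 (f a)) := by
  have h1 : Tendsto (fun ε : ℝ => ∫ τ, deriv Real.smoothTransition τ • f (a + ε * τ)) (𝓝[>] 0)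
      (𝓝 (∫ τ, deriv Real.smoothTransition τ • f a)) := by
    refine tendsto_integral_filter_of_dominated_convergence
      (fun τ => ‖deriv Real.smoothTransition τ‖ * C) ?_ ?_ ?_ ?_
    · exact Eventually.of_forall fun ε => (continuous_deriv_smoothTransition.smul
        (hf.comp (by fun_prop))).aestronglyMeasurable
    · refine Eventually.of_forall fun ε => Eventually.of_forall fun τ => ?_
      rw [norm_smul]
      gcongr
      exact hC _
    · exact integrable_deriv_smoothTransition.norm.mul_const C
    · refine Eventually.of_forall fun τ => ?_
      have : Continuous fun ε : ℝ => deriv Real.smoothTransition τ • f (a + ε * τ) := by fun_prop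
      simpa using (this.tendsto 0).mono_left nhdsWithin_le_nhds
  rw [integral_smul_const, integral_deriv_smoothTransition, one_smul] at h1
  refine h1.congr' ?_
  filter_upwards [self_mem_nhdsWithin] with ε hε
  have hε : 0 < ε := hε
  have h2 := integral_sub_right_eq_self (μ := volume)
    (fun s => (ε⁻¹ * deriv Real.smoothTransition (s / ε)) • f (a + s)) a
  have h3 := Measure.integral_comp_div
    (fun τ => (ε⁻¹ * deriv Real.smoothTransition τ) • f (a + ε * τ)) ε
  rw [abs_of_pos hε] at h3
  calc ∫ τ, deriv Real.smoothTransition τ • f (a + ε * τ)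
      = ε • ∫ τ, (ε⁻¹ * deriv Real.smoothTransition τ) • f (a + ε * τ) := by
        rw [← integral_smul]
        refine integral_congr_ae (Eventually.of_forall fun τ => ?_)
        simp only [smul_smul]
        rw [mul_inv_cancel_left₀ hε.ne']
    _ = ∫ s, (ε⁻¹ * deriv Real.smoothTransition (s / ε)) • f (a + s) := by
        rw [← h3]
        refine integral_congr_ae (Eventually.of_forall fun s => ?_)
        simp only
        rw [mul_div_cancel₀ _ hε.ne']
    _ = ∫ s, deriv (smoothStep a ε) s • f s := by
        rw [← h2]
        refine integral_congr_ae (Eventually.of_forall fun s => ?_)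
        simp only [deriv_smoothStep, add_sub_cancel]

/-- A continuous function with weak derivative `g` is a primitive of `g`. -/
theorem sub_eq_integral_of_weak_deriv [CompleteSpace X] {S : ℝ} {f g : ℝ → X}
    (hf : ContinuousOn f (Icc 0 S)) (hg : IntegrableOn g (Ioo 0 S))
    (hfg : ∀ φ : ℝ → ℝ, ContDiff ℝ ((⊤ : ℕ∞) : WithTop ℕ∞) φ → HasCompactSupport φ →
      tsupport φ ⊆ Ioo 0 S → ∫ s in Ioo 0 S, deriv φ s • f s = -∫ s in Ioo 0 S, φ s • g s)
    {a b : ℝ} (ha : 0 < a) (hab : a < b) (hb : b < S) : f b - f a = ∫ s in a..b, g s := by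
  have h0S : (0 : ℝ) ≤ S := by linarith
  -- Constant extension beyond the endpoints gives a bounded continuous function on the line, as the
  -- approximate identity requires.
  set F : ℝ → X := IccExtend h0S ((Icc 0 S).domRestrict f) with hF
  have hFc : Continuous F := hf.domRestrict.Icc_extend'
  have hFf {s : ℝ} (hs : s ∈ Icc 0 S) : F s = f s := IccExtend_of_mem h0S _ hs
  obtain ⟨C, hC⟩ := isCompact_Icc.exists_bound_of_continuousOn hf
  have hFC (s : ℝ) : ‖F s‖ ≤ C := by
    rw [hF, IccExtend_apply]
    exact hC _ (projIcc 0 S h0S s).2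
  -- These test functions tend to the indicator of `(a, b]` and their derivatives to `δ_a - δ_b`;
  -- since the steps rise to the right, the support lies in `[a, b + ε]`, inside `(0, S)` for small
  -- `ε`.
  set φ : ℝ → ℝ → ℝ := fun ε s => smoothStep a ε s - smoothStep b ε s with hφ
  have hφd (ε : ℝ) : ContDiff ℝ ((⊤ : ℕ∞) : WithTop ℕ∞) (φ ε) :=
    (contDiff_smoothStep a ε).sub (contDiff_smoothStep b ε)
  have hdφ (ε s : ℝ) : deriv (φ ε) s = deriv (smoothStep a ε) s - deriv (smoothStep b ε) s :=
    deriv_fun_sub ((contDiff_smoothStep a ε).differentiable (by simp) s)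
      ((contDiff_smoothStep b ε).differentiable (by simp) s)
  have hsmall : ∀ᶠ ε in 𝓝[>] (0 : ℝ), 0 < ε ∧ ε < S - b := by
    filter_upwards [Ioo_mem_nhdsGT (sub_pos.2 hb)] with ε hε using hε
  have hsupp {ε : ℝ} (h0 : 0 < ε) : Function.support (φ ε) ⊆ Icc a (b + ε) := by
    intro s hs
    by_contra h
    rw [mem_Icc, not_and_or, not_le, not_le] at h
    apply hs
    rcases h with h | h
    · simp only [hφ, smoothStep]
      rw [Real.smoothTransition.zero_of_nonpos (div_nonpos_of_nonpos_of_nonneg (by linarith) h0.le),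
        Real.smoothTransition.zero_of_nonpos (div_nonpos_of_nonpos_of_nonneg (by linarith) h0.le),
        sub_zero]
    · simp only [hφ, smoothStep]
      rw [Real.smoothTransition.one_of_one_le ((one_le_div h0).2 (by linarith)),
        Real.smoothTransition.one_of_one_le ((one_le_div h0).2 (by linarith)), sub_self]
  have hL : Tendsto (fun ε => ∫ s in Ioo 0 S, deriv (φ ε) s • f s) (𝓝[>] 0) (𝓝 (f a - f b)) := by
    have h1 := (tendsto_integral_deriv_smoothStep hFc hFC a).sub
      (tendsto_integral_deriv_smoothStep hFc hFC b)
    rw [hFf ⟨ha.le, by linarith⟩, hFf ⟨by linarith, hb.le⟩] at h1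
    refine h1.congr' ?_
    filter_upwards [hsmall] with ε hε
    have hint (c : ℝ) : Integrable fun s => deriv (smoothStep c ε) s • F s := by
      have h2 : Integrable (deriv (smoothStep c ε)) := by
        have h3 : deriv (smoothStep c ε)
            = fun s => ε⁻¹ * deriv Real.smoothTransition ((s - c) / ε) :=
          funext (deriv_smoothStep c ε)
        rw [h3]
        exact ((integrable_deriv_smoothTransition.comp_div hε.1.ne').comp_sub_right c).const_mul _
      exact h2.smul_bdd C hFc.aestronglyMeasurable (Eventually.of_forall hFC)
    rw [← integral_sub (hint a) (hint b)]
    have h4 : ∀ s, s ∉ Ioo 0 S → deriv (φ ε) s • F s = 0 := fun s hs => by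
      have : s ∉ tsupport (φ ε) := fun h => hs <| by
        have := closure_minimal (hsupp hε.1) isClosed_Icc h
        exact ⟨by linarith [this.1], by linarith [this.2, hε.2]⟩
      rw [show deriv (φ ε) s = 0 from by_contra fun h => this (support_deriv_subset h), zero_smul]
    calc ∫ s, deriv (smoothStep a ε) s • F s - deriv (smoothStep b ε) s • F s
        = ∫ s, deriv (φ ε) s • F s := by
          refine integral_congr_ae (Eventually.of_forall fun s => ?_)
          simp only [hdφ, sub_smul]
      _ = ∫ s in Ioo 0 S, deriv (φ ε) s • F s := (setIntegral_eq_integral_of_forall_compl_eq_zero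
          fun s hs => h4 s hs).symm
      _ = _ := setIntegral_congr_fun measurableSet_Ioo fun s hs => by
          simp only [hFf ⟨hs.1.le, hs.2.le⟩]
  have hR : Tendsto (fun ε => ∫ s in Ioo 0 S, φ ε s • g s) (𝓝[>] 0) (𝓝 (∫ s in a..b, g s)) := by
    have h1 : ∫ s in a..b, g s = ∫ s in Ioo 0 S, (Ioc a b).indicator (1 : ℝ → ℝ) s • g s := by
      have h2 (s : ℝ) : (Ioc a b).indicator (1 : ℝ → ℝ) s • g s = (Ioc a b).indicator g s := by
        by_cases hs : s ∈ Ioc a b <;> simp [hs]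
      simp_rw [h2]
      rw [intervalIntegral.integral_of_le hab.le, setIntegral_indicator measurableSet_Ioc,
        inter_eq_right.2]
      exact fun s hs => ⟨ha.trans hs.1, hs.2.trans_lt hb⟩
    rw [h1]
    refine tendsto_integral_filter_of_dominated_convergence (fun s => ‖g s‖) ?_ ?_ hg.norm ?_
    · exact Eventually.of_forall fun ε => (hφd ε).continuous.aestronglyMeasurable.smul
        hg.aestronglyMeasurable
    · refine Eventually.of_forall fun ε => Eventually.of_forall fun s => ?_
      rw [norm_smul]
      refine mul_le_of_le_one_left (norm_nonneg _) ?_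
      simp only [hφ, smoothStep, Real.norm_eq_abs]
      rw [abs_le]
      constructor <;>
      linarith [Real.smoothTransition.nonneg ((s - a) / ε), Real.smoothTransition.le_one ((s - a) / ε),
        Real.smoothTransition.nonneg ((s - b) / ε), Real.smoothTransition.le_one ((s - b) / ε)]
    · refine Eventually.of_forall fun s => Tendsto.smul_const ?_ _
      -- At `s = c` the step is `0`, so the limit is exactly the half-open indicator.
      have hstep (c : ℝ) : ∀ᶠ ε in 𝓝[>] (0 : ℝ), smoothStep c ε s = if c < s then 1 else 0 := by
        split_ifs with h
        · filter_upwards [Ioo_mem_nhdsGT (sub_pos.2 h)] with ε hε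
          exact Real.smoothTransition.one_of_one_le ((one_le_div hε.1).2 hε.2.le)
        · filter_upwards [self_mem_nhdsWithin] with ε hε
          exact Real.smoothTransition.zero_of_nonpos
            (div_nonpos_of_nonpos_of_nonneg (by linarith) (le_of_lt hε))
      refine tendsto_const_nhds.congr' ?_
      filter_upwards [hstep a, hstep b] with ε h3 h4
      simp only [hφ, h3, h4, indicator_apply, mem_Ioc, Pi.one_apply]
      split_ifs <;> grind
  have heq : Tendsto (fun ε => ∫ s in Ioo 0 S, deriv (φ ε) s • f s) (𝓝[>] 0)
      (𝓝 (-∫ s in a..b, g s)) := by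
    refine hR.neg.congr' ?_
    filter_upwards [hsmall] with ε hε
    refine (hfg (φ ε) (hφd ε) (HasCompactSupport.of_support_subset_isCompact isCompact_Icc
      (hsupp hε.1)) ?_).symm
    refine (closure_minimal (hsupp hε.1) isClosed_Icc).trans fun s hs => ?_
    exact ⟨by linarith [hs.1], by linarith [hs.2, hε.2]⟩
  rw [← neg_sub, tendsto_nhds_unique hL heq, neg_neg]

/-- Test functions see only interior points: `f` minus the primitive is constant on `(0, S)` by
comparison with the midpoint, and continuity extends this to both endpoints. -/
theorem MemW1.exists_eq_integral [CompleteSpace X] {q : ℝ≥0∞} (hq : 1 ≤ q) {S : ℝ} (hS : 0 < S)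
    {f : ℝ → X} (hf : MemW1 q S f) :
    ∃ g : ℝ → X, IntervalIntegrable g volume 0 S ∧
      ∀ s ∈ Icc 0 S, f s = f 0 + ∫ τ in (0 : ℝ)..s, g τ := by
  obtain ⟨hc, -, g, hg, hfg⟩ := hf
  have hgi : IntegrableOn g (Ioo 0 S) := hg.integrable hq
  have hgI : IntervalIntegrable g volume 0 S :=
    (intervalIntegrable_iff_integrableOn_Ioo_of_le hS.le).2 hgi
  refine ⟨g, hgI, fun s hs => ?_⟩
  have hsub {a b : ℝ} (ha : a ∈ Icc 0 S) (hb : b ∈ Icc 0 S) : IntervalIntegrable g volume a b :=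
    hgI.mono_set (by
      rw [uIcc_of_le hS.le]
      exact uIcc_subset_Icc ha hb)
  set m := S / 2 with hm
  have hm0 : m ∈ Ioo 0 S := ⟨by linarith, by linarith⟩
  have hcont : ContinuousOn (fun s => ∫ τ in (0 : ℝ)..s, g τ) (Icc 0 S) := by
    have := intervalIntegral.continuousOn_primitive_interval'  hgI (a := 0) (by simp)
    rwa [uIcc_of_le hS.le] at this
  have heq : EqOn (fun s => f s - ∫ τ in (0 : ℝ)..s, g τ)
      (fun _ => f m - ∫ τ in (0 : ℝ)..m, g τ) (Ioo 0 S) := by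
    intro r hr
    have h0 : (0 : ℝ) ∈ Icc 0 S := ⟨le_rfl, hS.le⟩
    have hrI := Ioo_subset_Icc_self hr
    have hmI := Ioo_subset_Icc_self hm0
    have hadd := intervalIntegral.integral_add_adjacent_intervals (hsub h0 hmI) (hsub hmI hrI)
    have key : f r - f m = ∫ τ in m..r, g τ := by
      rcases lt_trichotomy m r with h | h | h
      · exact sub_eq_integral_of_weak_deriv hc hgi hfg hm0.1 h hr.2
      · rw [h]; simp
      · rw [intervalIntegral.integral_symm,
          ← sub_eq_integral_of_weak_deriv hc hgi hfg hr.1 h hm0.2, neg_sub]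
    simp only
    rw [← hadd, ← key]
    abel
  have hall := heq.of_subset_closure (hc.sub hcont) continuousOn_const Ioo_subset_Icc_self
    (by rw [closure_Ioo hS.ne])
  have e1 := hall hs
  have e2 := hall (show (0 : ℝ) ∈ Icc 0 S from ⟨le_rfl, hS.le⟩)
  simp only [intervalIntegral.integral_same, sub_zero] at e1 e2
  rw [e2, ← e1]
  abel

/-- Lebesgue differentiation of the primitive. The endpoints are discarded because nothing is known
about `f` outside `[0, S]`. -/
theorem MemW1.ae_differentiableAt [CompleteSpace X] {q : ℝ≥0∞} (hq : 1 ≤ q) {S : ℝ} (hS : 0 < S)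
    {f : ℝ → X} (hf : MemW1 q S f) :
    ∀ᵐ s ∂volume.restrict (Icc 0 S), DifferentiableAt ℝ f s := by
  obtain ⟨g, hg, hfg⟩ := hf.exists_eq_integral hq hS
  rw [ae_restrict_iff' measurableSet_Icc]
  have h0 : ∀ᵐ s : ℝ, s ≠ 0 := by simp [ae_iff, measure_singleton]
  have h1 : ∀ᵐ s : ℝ, s ≠ S := by simp [ae_iff, measure_singleton]
  filter_upwards [hg.ae_hasDerivAt_integral, h0, h1] with s hs hs0 hsS hsI
  rw [uIcc_of_le hS.le] at hs
  have hd := (hs hsI 0 ⟨le_rfl, hS.le⟩).const_add (f 0)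
  refine (hd.congr_of_eventuallyEq ?_).differentiableAt
  filter_upwards [Ioo_mem_nhds (lt_of_le_of_ne hsI.1 hs0.symm) (lt_of_le_of_ne hsI.2 hsS)]
    with r hr using hfg r (Ioo_subset_Icc_self hr)

/-! ### Absolute continuity of curves in normed spaces -/

theorem _root_.AbsolutelyContinuousOnInterval.of_dist_le {Y W : Type*} [PseudoMetricSpace Y]
    [PseudoMetricSpace W] {f : ℝ → Y} {h : ℝ → W} {a b : ℝ} {C : ℝ}
    (hh : AbsolutelyContinuousOnInterval h a b)
    (hle : ∀ x ∈ uIcc a b, ∀ y ∈ uIcc a b, dist (f x) (f y) ≤ C * dist (h x) (h y)) :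
    AbsolutelyContinuousOnInterval f a b := by
  have h1 := Tendsto.const_mul C (show Tendsto _ _ (𝓝 0) from hh)
  rw [mul_zero] at h1
  refine squeeze_zero' (Eventually.of_forall fun E => Finset.sum_nonneg fun i _ => dist_nonneg) ?_ h1
  filter_upwards [mem_inf_of_right (mem_principal_self _)] with E hE
  rw [Finset.mul_sum]
  exact Finset.sum_le_sum fun i hi => hle _ (hE.1 i hi).1 _ (hE.1 i hi).2

theorem _root_.AbsolutelyContinuousOnInterval.bilin {Y W H : Type*} [NormedAddCommGroup Y]
    [NormedSpace ℝ Y] [NormedAddCommGroup W] [NormedSpace ℝ W] [NormedAddCommGroup H]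
    [NormedSpace ℝ H] (B : Y →L[ℝ] W →L[ℝ] H) {f : ℝ → Y} {g : ℝ → W} {a b : ℝ}
    (hf : AbsolutelyContinuousOnInterval f a b) (hg : AbsolutelyContinuousOnInterval g a b) :
    AbsolutelyContinuousOnInterval (fun s => B (f s) (g s)) a b := by
  obtain ⟨Cf, hCf⟩ := hf.exists_bound
  obtain ⟨Cg, hCg⟩ := hg.exists_bound
  have h1 := (Tendsto.const_mul (‖B‖ * Cf) (show Tendsto _ _ (𝓝 0) from hg)).add
    (Tendsto.const_mul (‖B‖ * Cg) (show Tendsto _ _ (𝓝 0) from hf))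
  rw [mul_zero, mul_zero, add_zero] at h1
  refine squeeze_zero' (Eventually.of_forall fun E => Finset.sum_nonneg fun i _ => dist_nonneg) ?_ h1
  filter_upwards [mem_inf_of_right (mem_principal_self _)] with E hE
  rw [Finset.mul_sum, Finset.mul_sum, ← Finset.sum_add_distrib]
  refine Finset.sum_le_sum fun i hi => ?_
  obtain ⟨hx, hy⟩ := hE.1 i hi
  set x := (E.2 i).1
  set y := (E.2 i).2
  rw [dist_eq_norm, dist_eq_norm, dist_eq_norm]
  have h2 : B (f x) (g x) - B (f y) (g y) = B (f x) (g x - g y) + B (f x - f y) (g y) := by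
    simp
  rw [h2]
  refine (norm_add_le _ _).trans (add_le_add ?_ ?_)
  · refine (B.le_opNorm₂ _ _).trans ?_
    gcongr
    exact hCf x hx
  · refine (B.le_opNorm₂ _ _).trans ?_
    rw [mul_right_comm]
    gcongr
    exact hCg y hy

/-- Increments of `f` are dominated by those of the real primitive of `‖g‖`, which is absolutely
continuous. -/
theorem MemW1.absolutelyContinuousOnInterval [CompleteSpace X] {q : ℝ≥0∞} (hq : 1 ≤ q) {S : ℝ}
    (hS : 0 < S) {f : ℝ → X} (hf : MemW1 q S f) : AbsolutelyContinuousOnInterval f 0 S := by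
  obtain ⟨g, hg, hfg⟩ := hf.exists_eq_integral hq hS
  refine (hg.norm.absolutelyContinuousOnInterval_intervalIntegral (c := 0) (by simp)).of_dist_le
    (C := 1) fun x hx y hy => ?_
  have h0 : (0 : ℝ) ∈ uIcc 0 S := left_mem_uIcc
  have i1 : IntervalIntegrable g volume 0 x := hg.mono_set (uIcc_subset_uIcc h0 hx)
  have i2 : IntervalIntegrable g volume 0 y := hg.mono_set (uIcc_subset_uIcc h0 hy)
  rw [uIcc_of_le hS.le] at hx hy
  rw [hfg x hx, hfg y hy, dist_add_left, dist_eq_norm, dist_eq_norm, one_mul,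
    intervalIntegral.integral_interval_sub_left i1 i2,
    intervalIntegral.integral_interval_sub_left i1.norm i2.norm, Real.norm_eq_abs]
  exact intervalIntegral.norm_integral_le_abs_integral_norm

end Interval

/-! ### Continuous embeddings -/

section Embeddings

variable {G : Geometry} {H : Type} [NormedAddCommGroup H] [NormedSpace ℝ H]

/-- With this exponent the inclusion `L^r ↪ L^q` becomes Hölder multiplication by the constant `1`,
hence a bounded linear map. -/
theorem holderTriple_inv_sub {q r : ℝ≥0∞} (h : q ≤ r) :
    ENNReal.HolderTriple (q⁻¹ - r⁻¹)⁻¹ r q where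
  inv_add_inv_eq_inv := by rw [inv_inv, tsub_add_cancel_of_le (ENNReal.inv_le_inv.2 h)]

/-- The embedding `L^r(Ω) ↪ L^q(Ω)` for `q ≤ r`. -/
def lpIncl {q r : ℝ≥0∞} [hq : Fact (1 ≤ q)] [Fact (1 ≤ r)] (h : q ≤ r) :
    Lp H r G.μ →L[ℝ] Lp H q G.μ :=
  haveI := holderTriple_inv_sub h
  haveI : Fact (1 ≤ (q⁻¹ - r⁻¹)⁻¹) :=
    ⟨ENNReal.one_le_inv.2 (tsub_le_self.trans (ENNReal.inv_le_one.2 hq.out))⟩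
  (ContinuousLinearMap.lsmul ℝ ℝ : ℝ →L[ℝ] H →L[ℝ] H).holderL G.μ (q⁻¹ - r⁻¹)⁻¹ r q
    ((memLp_const (1 : ℝ)).toLp _)

theorem coeFn_lpIncl {q r : ℝ≥0∞} [Fact (1 ≤ q)] [Fact (1 ≤ r)] (h : q ≤ r)
    (f : Lp H r G.μ) : lpIncl h f =ᵐ[G.μ] f := by
  have := holderTriple_inv_sub h
  have h1 := (ContinuousLinearMap.lsmul ℝ ℝ : ℝ →L[ℝ] H →L[ℝ] H).coeFn_holder (r := q)
    ((memLp_const (1 : ℝ)).toLp _ : Lp ℝ (q⁻¹ - r⁻¹)⁻¹ G.μ) f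
  have h2 := (memLp_const (1 : ℝ) (p := (q⁻¹ - r⁻¹)⁻¹) (μ := G.μ)).coeFn_toLp
  filter_upwards [h1, h2] with x hx1 hx2
  refine hx1.trans ?_
  rw [hx2]
  exact one_smul ℝ _

theorem FieldPair.lower_eq {q r : ℝ≥0∞} [Fact (1 ≤ q)] [Fact (1 ≤ r)] (h : q ≤ r)
    (w : FieldPair H G r) :
    w.lower h = WithLp.toLp q (lpIncl h w.fst, lpIncl h w.snd) := by
  rw [FieldPair.lower]
  congr 2
  · exact Lp.ext ((MemLp.coeFn_toLp _).trans (coeFn_lpIncl h _).symm)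
  · exact Lp.ext ((MemLp.coeFn_toLp _).trans (coeFn_lpIncl h _).symm)

/-- `FieldPair.lower` as a continuous linear map. -/
def FieldPair.lowerL {q r : ℝ≥0∞} [Fact (1 ≤ q)] [Fact (1 ≤ r)] (h : q ≤ r) :
    FieldPair H G r →L[ℝ] FieldPair H G q :=
  (WithLp.prodContinuousLinearEquiv q ℝ (Lp H q G.μ)
    (Lp (GradVal H) q G.μ)).symm.toContinuousLinearMap ∘L
    ((lpIncl h ∘L WithLp.fstL r ℝ _ _).prod (lpIncl h ∘L WithLp.sndL r ℝ _ _))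

/-- `U.lower` as a continuous linear map. -/
def U.lowerL {q r : ℝ≥0∞} [Fact (1 ≤ q)] [Fact (1 ≤ r)] (h : q ≤ r) : U G r →L[ℝ] U G q :=
  ((FieldPair.lowerL h) ∘L (sobolevD E2 G r).subtypeL).codRestrict (sobolevD E2 G q) fun u => by
    have : (FieldPair.lowerL h) u.1 = (U.lower h u).1 := (FieldPair.lower_eq h u.1).symm
    exact this ▸ (U.lower h u).2

theorem U.lowerL_apply {q r : ℝ≥0∞} [Fact (1 ≤ q)] [Fact (1 ≤ r)] (h : q ≤ r) (u : U G r) :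
    U.lowerL h u = u.lower h :=
  Subtype.ext (FieldPair.lower_eq h u.1).symm

theorem U.grad_lower {q r : ℝ≥0∞} [Fact (1 ≤ q)] [Fact (1 ≤ r)] (h : q ≤ r) (u : U G r) :
    (u.lower h).grad =ᵐ[G.μ] u.grad :=
  ((Lp.memLp u.1.snd).mono_exponent h).coeFn_toLp

/-- The gradient as a continuous linear map `U^r → L²(Ω)`. -/
def gradL {r : ℝ≥0∞} [Fact (1 ≤ r)] (h : 2 ≤ r) : U G r →L[ℝ] Lp (GradVal E2) 2 G.μ :=
  lpIncl h ∘L WithLp.sndL r ℝ _ _ ∘L (sobolevD E2 G r).subtypeL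

theorem coeFn_gradL {r : ℝ≥0∞} [Fact (1 ≤ r)] (h : 2 ≤ r) (u : U G r) :
    gradL h u =ᵐ[G.μ] u.grad :=
  coeFn_lpIncl h _

/-- The exponent `q = 6 p / (p - 2)`, for which `1/q + 1/p̃ = 1/2`. -/
def Exponents.qExp (e : Exponents) : ℝ≥0∞ := ENNReal.ofReal (6 * e.p / (e.p - 2))

theorem Exponents.two_le_qExp (e : Exponents) : 2 ≤ e.qExp := by
  have := e.two_lt_p
  rw [qExp, show (2 : ℝ≥0∞) = ENNReal.ofReal 2 by simp]
  refine ENNReal.ofReal_le_ofReal ?_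
  rw [le_div_iff₀ (by linarith)]
  linarith

instance (e : Exponents) : Fact (1 ≤ e.qExp) :=
  ⟨le_trans (by norm_num) e.two_le_qExp⟩

instance (e : Exponents) : ENNReal.HolderTriple e.qExp e.pTilde 2 where
  inv_add_inv_eq_inv := by
    have := e.two_lt_p
    have h1 : (0 : ℝ) < 6 * e.p / (e.p - 2) := div_pos (by linarith) (by linarith)
    have h2 : (0 : ℝ) < 3 * e.p / (e.p + 1) := div_pos (by linarith) (by linarith)
    rw [Exponents.qExp, Exponents.pTilde, ← ENNReal.ofReal_inv_of_pos h1,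
      ← ENNReal.ofReal_inv_of_pos h2, ← ENNReal.ofReal_add (by positivity) (by positivity),
      show (2 : ℝ≥0∞) = ENNReal.ofReal 2 by simp, ← ENNReal.ofReal_inv_of_pos (by norm_num)]
    congr 1
    have h3 : e.p - 2 ≠ 0 := by linarith
    have h4 : e.p + 1 ≠ 0 := by linarith
    have h5 : e.p ≠ 0 := by linarith
    field_simp
    ring

theorem Z.memLp_qExp (e : Exponents) (z : Z G) : MemLp z.fn e.qExp G.μ := by
  obtain ⟨k, hk⟩ := exists_nat_ge (6 * e.p / (e.p - 2))
  refine (z.memLp_fn k).mono_exponent ?_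
  rw [Exponents.qExp, ← ENNReal.ofReal_natCast]
  refine ENNReal.ofReal_le_ofReal (hk.trans ?_)
  push_cast
  linarith [(Nat.cast_nonneg k : (0 : ℝ) ≤ k)]

theorem Z.fn_add (z y : Z G) : (z + y).fn =ᵐ[G.μ] z.fn + y.fn :=
  Lp.coeFn_add z.1.fst y.1.fst

theorem Z.fn_smul (c : ℝ) (z : Z G) : (c • z).fn =ᵐ[G.μ] c • z.fn :=
  Lp.coeFn_smul c z.1.fst

/-- The Sobolev embedding `H¹(Ω) ↪ L^q(Ω)`. -/
def Z.toLqₗ (e : Exponents) : Z G →ₗ[ℝ] Lp ℝ e.qExp G.μ where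
  toFun z := (z.memLp_qExp e).toLp _
  map_add' z y := by
    rw [← MemLp.toLp_add]
    exact (MemLp.toLp_eq_toLp_iff _ _).2 (Z.fn_add z y)
  map_smul' c z := by
    rw [RingHom.id_apply, ← MemLp.toLp_const_smul]
    exact (MemLp.toLp_eq_toLp_iff _ _).2 (Z.fn_smul c z)

/-- The Sobolev embedding `H¹(Ω) ↪ L^q(Ω)` is continuous. -/
def Z.toLq (e : Exponents) : Z G →L[ℝ] Lp ℝ e.qExp G.μ :=
  -- Closed graph: convergence in `H¹` and convergence in `L^q` both imply convergence in `L²`, so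
  -- the two limits agree. No quantitative form of the embedding is needed.
  ContinuousLinearMap.ofSeqClosedGraph (g := Z.toLqₗ e) fun v z y hv hy => by
    have h1 : Filter.Tendsto (fun n => lpIncl e.two_le_qExp (Z.toLqₗ e (v n))) Filter.atTop
        (nhds (lpIncl e.two_le_qExp y)) :=
      ((lpIncl e.two_le_qExp).continuous.tendsto y).comp hy
    have hfst (x : Z G) : lpIncl e.two_le_qExp (Z.toLqₗ e x) = x.1.fst :=
      Lp.ext ((coeFn_lpIncl e.two_le_qExp (Z.toLqₗ e x)).trans
        (x.memLp_qExp e).coeFn_toLp)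
    have h2 : Filter.Tendsto (fun n => (v n).1.fst) Filter.atTop (nhds z.1.fst) :=
      (((WithLp.fstL 2 ℝ _ _ ∘L (sobolev ℝ G 2).subtypeL).continuous.tendsto z).comp hv :)
    simp_rw [hfst] at h1
    have h3 : lpIncl e.two_le_qExp y = z.1.fst := tendsto_nhds_unique h1 h2
    refine Lp.ext ((coeFn_lpIncl e.two_le_qExp y).symm.trans ?_)
    rw [h3]
    exact (MemLp.coeFn_toLp (z.memLp_qExp e)).symm

theorem Z.coeFn_toLq (e : Exponents) (z : Z G) : Z.toLq e z =ᵐ[G.μ] z.fn :=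
  MemLp.coeFn_toLp (z.memLp_qExp e)

/-- The bilinear map `(z, u) ↦ z ∇u` from `H¹(Ω) × U^{p̃}` to `L²(Ω)`. -/
def mulGrad (G : Geometry) (e : Exponents) :
    Z G →L[ℝ] U G e.pTilde →L[ℝ] Lp (GradVal E2) 2 G.μ :=
  ((ContinuousLinearMap.lsmul ℝ ℝ : ℝ →L[ℝ] GradVal E2 →L[ℝ] GradVal E2).holderL G.μ
    e.qExp e.pTilde 2).bilinearComp (Z.toLq e)
    (WithLp.sndL e.pTilde ℝ _ _ ∘L (sobolevD E2 G e.pTilde).subtypeL)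

theorem coeFn_mulGrad (e : Exponents) (z : Z G) (u : U G e.pTilde) :
    mulGrad G e z u =ᵐ[G.μ] fun x => z.fn x • u.grad x := by
  have h1 := (ContinuousLinearMap.lsmul ℝ ℝ : ℝ →L[ℝ] GradVal E2 →L[ℝ] GradVal E2).coeFn_holder
    (r := 2) (Z.toLq e z) u.1.snd
  filter_upwards [h1, Z.coeFn_toLq e z] with x hx1 hx2
  refine hx1.trans ?_
  rw [hx2]
  rfl

end Embeddings

/-! ### The elastic energy as a bounded symmetric form -/

section ElasticForm

variable {G : Geometry} {e : Exponents}

theorem frob_eq_sum (A B : SymMat) : frob A B = ∑ i, ∑ j, A.1 i j * B.1 i j := by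
  simp only [frob, Matrix.trace, Matrix.diag, Matrix.mul_apply, Matrix.transpose_apply,
    Fin.sum_univ_two]
  ring

theorem symPart_add (g h : GradVal E2) : symPart (g + h) = symPart g + symPart h := by
  refine Subtype.ext (Matrix.ext fun i j => ?_)
  simp [symPart]
  ring

theorem symPart_smul (c : ℝ) (g : GradVal E2) : symPart (c • g) = c • symPart g := by
  refine Subtype.ext (Matrix.ext fun i j => ?_)
  simp [symPart]
  ring

theorem frob_add_left (A A' B : SymMat) : frob (A + A') B = frob A B + frob A' B := by
  simp only [frob_eq_sum, ← Finset.sum_add_distrib, Submodule.coe_add, Matrix.add_apply, add_mul]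

theorem frob_smul_left (c : ℝ) (A B : SymMat) : frob (c • A) B = c * frob A B := by
  simp only [frob_eq_sum, Finset.mul_sum, Submodule.coe_smul, Matrix.smul_apply, smul_eq_mul,
    mul_assoc]

theorem frob_comm (A B : SymMat) : frob A B = frob B A := by
  simp only [frob_eq_sum, mul_comm]

/-- The standard basis of the space of gradients. -/
def gradBasis (k : Fin 2 × Fin 2) : GradVal E2 :=
  WithLp.toLp 2 (Pi.single k.1 (EuclideanSpace.single k.2 1))

/-- The coordinates of a gradient. -/
def gradCoord (k : Fin 2 × Fin 2) : GradVal E2 →L[ℝ] ℝ :=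
  (PiLp.proj 2 (fun _ : Fin 2 => ℝ) k.2) ∘L (PiLp.proj 2 (fun _ : Fin 2 => E2) k.1)

theorem sum_gradCoord_smul (g : GradVal E2) : ∑ k, gradCoord k g • gradBasis k = g := by
  ext i j
  rw [Fintype.sum_prod_type]
  fin_cases i <;> fin_cases j <;> simp [gradCoord, gradBasis]

namespace Model

variable (M : Model G e)

/-- The coefficients of the bilinear form `(g, h) ↦ C(x) sym(g) : sym(h)`. -/
def gradCoeff (k l : Fin 2 × Fin 2) (x : E2) : ℝ :=
  frob (M.C x (symPart (gradBasis k))) (symPart (gradBasis l))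

/-- The tensor is only known to have bounded entries on each fixed matrix; expanding in a basis
reduces measurability and integrability for varying gradients to scalar `L^∞` weights. -/
theorem frob_symPart_eq_sum (x : E2) (g h : GradVal E2) :
    frob (M.C x (symPart g)) (symPart h)
      = ∑ k, ∑ l, M.gradCoeff k l x * gradCoord k g * gradCoord l h := by
  set B : GradVal E2 →ₗ[ℝ] GradVal E2 →ₗ[ℝ] ℝ :=
    LinearMap.mk₂ ℝ (fun g h => frob (M.C x (symPart g)) (symPart h))
      (fun g g' h => by simp only [symPart_add, map_add, frob_add_left])
      (fun c g h => by simp only [symPart_smul, map_smul, frob_smul_left, smul_eq_mul])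
      (fun g h h' => by
        simp only [frob_comm (M.C x (symPart g)), symPart_add, frob_add_left])
      (fun c g h => by
        simp only [frob_comm (M.C x (symPart g)), symPart_smul, frob_smul_left, smul_eq_mul])
  have hB (g h : GradVal E2) : frob (M.C x (symPart g)) (symPart h) = B g h := rfl
  conv_lhs => rw [hB, ← sum_gradCoord_smul g, ← sum_gradCoord_smul h]
  simp only [gradCoeff, hB, map_sum, map_smul, LinearMap.sum_apply, LinearMap.smul_apply,
    smul_eq_mul, Finset.mul_sum]
  rw [Finset.sum_comm]
  exact Finset.sum_congr rfl fun k _ => Finset.sum_congr rfl fun l _ => by ring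

theorem memLp_gradCoeff (k l : Fin 2 × Fin 2) : MemLp (M.gradCoeff k l) ⊤ G.μ := by
  have h : M.gradCoeff k l = fun x => ∑ i, ∑ j, (M.C x (symPart (gradBasis k))).1 i j *
      (symPart (gradBasis l)).1 i j := funext fun x => frob_eq_sum _ _
  rw [h]
  exact memLp_finsetSum _ fun i _ => memLp_finsetSum _ fun j _ => (M.C_bdd _ i j).mul_const _

/-- The form `(f, g) ↦ ∫_Ω c f g dx` on `L²(Ω)`, for a bounded coefficient `c`. -/
def weightedForm (G : Geometry) (c : Lp ℝ ⊤ G.μ) : Lp ℝ 2 G.μ →L[ℝ] Lp ℝ 2 G.μ →L[ℝ] ℝ :=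
  ((ContinuousLinearMap.mul ℝ ℝ).lpPairing G.μ 2 2) ∘L
    ((ContinuousLinearMap.mul ℝ ℝ).holderL G.μ ⊤ 2 2 c)

theorem weightedForm_apply (c : Lp ℝ ⊤ G.μ) (f g : Lp ℝ 2 G.μ) :
    weightedForm G c f g = ∫ x, c x * f x * g x ∂G.μ := by
  refine ((ContinuousLinearMap.mul ℝ ℝ).lpPairing_eq_integral (μ := G.μ) (p := 2) (q := 2)
    ((ContinuousLinearMap.mul ℝ ℝ).holderL G.μ ⊤ 2 2 c f) g).trans (integral_congr_ae ?_)
  filter_upwards [(ContinuousLinearMap.mul ℝ ℝ).coeFn_holder (r := 2) c f] with x hx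
  exact congrArg (· * g x) hx

theorem integrable_weighted (c : Lp ℝ ⊤ G.μ) (f g : Lp ℝ 2 G.μ) :
    Integrable (fun x => c x * f x * g x) G.μ :=
  memLp_one_iff_integrable.1
    ((Lp.memLp g).mul (p := 2) ((Lp.memLp f).mul (p := ⊤) (r := 2) (Lp.memLp c)))

/-- The coordinates of gradient fields. -/
def coordL (G : Geometry) (k : Fin 2 × Fin 2) : Lp (GradVal E2) 2 G.μ →L[ℝ] Lp ℝ 2 G.μ :=
  (gradCoord k).compLpL 2 G.μ

theorem coeFn_coordL (k : Fin 2 × Fin 2) (v : Lp (GradVal E2) 2 G.μ) :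
    coordL G k v =ᵐ[G.μ] fun x => gradCoord k (v x) :=
  (gradCoord k).coeFn_compLpL v

/-- The form `(v, w) ↦ ∫_Ω C sym(v) : sym(w) dx` on `L²(Ω)`. -/
def elasticForm :
    Lp (GradVal E2) 2 G.μ →L[ℝ] Lp (GradVal E2) 2 G.μ →L[ℝ] ℝ :=
  ∑ k, ∑ l, (weightedForm G ((M.memLp_gradCoeff k l).toLp _)).bilinearComp (coordL G k) (coordL G l)

theorem weightedForm_coordL_ae (k l : Fin 2 × Fin 2) (v w : Lp (GradVal E2) 2 G.μ) :
    (fun x => (M.memLp_gradCoeff k l).toLp _ x * coordL G k v x * coordL G l w x)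
      =ᵐ[G.μ] fun x => M.gradCoeff k l x * gradCoord k (v x) * gradCoord l (w x) := by
  filter_upwards [(M.memLp_gradCoeff k l).coeFn_toLp, coeFn_coordL k v, coeFn_coordL l w]
    with x h1 h2 h3
  rw [h1, h2, h3]

theorem integrable_gradCoeff_mul (k l : Fin 2 × Fin 2) (v w : Lp (GradVal E2) 2 G.μ) :
    Integrable (fun x => M.gradCoeff k l x * gradCoord k (v x) * gradCoord l (w x)) G.μ :=
  (integrable_weighted _ _ _).congr (M.weightedForm_coordL_ae k l v w)

theorem elasticForm_apply (v w : Lp (GradVal E2) 2 G.μ) :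
    M.elasticForm v w = ∫ x, frob (M.C x (symPart (v x))) (symPart (w x)) ∂G.μ := by
  simp only [elasticForm, sum_apply, ContinuousLinearMap.bilinearComp_apply, weightedForm_apply,
    frob_symPart_eq_sum]
  rw [integral_finsetSum _ fun k _ => integrable_finsetSum _ fun l _ =>
    M.integrable_gradCoeff_mul k l v w]
  refine Finset.sum_congr rfl fun k _ => ?_
  rw [integral_finsetSum _ fun l _ => M.integrable_gradCoeff_mul k l v w]
  exact Finset.sum_congr rfl fun l _ => integral_congr_ae (M.weightedForm_coordL_ae k l v w)

theorem integrable_elastic (v w : Lp (GradVal E2) 2 G.μ) :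
    Integrable (fun x => frob (M.C x (symPart (v x))) (symPart (w x))) G.μ := by
  simp only [frob_symPart_eq_sum]
  exact integrable_finsetSum _ fun k _ => integrable_finsetSum _ fun l _ =>
    M.integrable_gradCoeff_mul k l v w

theorem elasticForm_symm (v w : Lp (GradVal E2) 2 G.μ) :
    M.elasticForm v w = M.elasticForm w v := by
  rw [elasticForm_apply, elasticForm_apply]
  -- The exceptional null set in `C_symm` depends on the pair of matrices; the finitely many basis
  -- pairs share one.
  have h1 : ∀ᵐ x ∂G.μ, ∀ k l, M.gradCoeff k l x = M.gradCoeff l k x :=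
    ae_all_iff.2 fun k => ae_all_iff.2 fun l => M.C_symm _ _
  refine integral_congr_ae ?_
  filter_upwards [h1] with x hx
  simp only [frob_symPart_eq_sum]
  rw [Finset.sum_comm]
  refine Finset.sum_congr rfl fun k _ => Finset.sum_congr rfl fun l _ => ?_
  rw [hx]
  ring

/-- Absorbing one factor `z` into each gradient turns the cubic-looking weight `z²` into the fixed
form `elasticForm` evaluated at `z∇u` and `z∇v`. The functions `a` and `b` allow for the different
representatives of the gradient after lowering the exponent. -/
theorem integral_damaged_elastic (u v : U G e.pTilde) (z : Z G) {a b : E2 → GradVal E2}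
    (ha : a =ᵐ[G.μ] u.grad) (hb : b =ᵐ[G.μ] v.grad) :
    ∫ x, (z.fn x ^ 2 + M.η) * frob (M.C x (symPart (a x))) (symPart (b x)) ∂G.μ
      = M.elasticForm (mulGrad G e z u) (mulGrad G e z v)
        + M.η * M.elasticForm (gradL e.two_le_pTilde u) (gradL e.two_le_pTilde v) := by
  rw [elasticForm_apply, elasticForm_apply, ← integral_const_mul,
    ← integral_add (M.integrable_elastic _ _) ((M.integrable_elastic _ _).const_mul _)]
  refine integral_congr_ae ?_
  filter_upwards [coeFn_mulGrad e z u, coeFn_mulGrad e z v, coeFn_gradL e.two_le_pTilde u,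
    coeFn_gradL e.two_le_pTilde v, ha, hb] with x h1 h2 h3 h4 h5 h6
  rw [h1, h2, h3, h4, h5, h6, symPart_smul, symPart_smul, map_smul, frob_smul_left,
    frob_comm _ (z.fn x • _), frob_smul_left, frob_comm (symPart (v.grad x))]
  ring

/-- The embedding of `U^{p̃}` into `U^{p'}`. -/
def loadL (G : Geometry) (e : Exponents) : U G e.pTilde →L[ℝ] U G e.pConj :=
  U.lowerL e.pConj_le_two ∘L U.lowerL e.two_le_pTilde

theorem loadL_apply (u : U G e.pTilde) :
    loadL G e u = (u.lower e.two_le_pTilde).lower e.pConj_le_two := by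
  rw [loadL, ContinuousLinearMap.comp_apply, U.lowerL_apply, U.lowerL_apply]

theorem energyT_eq (t : ℝ) (u : U G e.pTilde) (z : Z G) :
    M.energyT t u z = M.κ / 2 * ‖z‖ ^ 2
      + 1 / 2 * (M.elasticForm (mulGrad G e z u) (mulGrad G e z u)
        + M.η * M.elasticForm (gradL e.two_le_pTilde u) (gradL e.two_le_pTilde u))
      - M.ℓ t (loadL G e u) := by
  rw [energyT, energy, loadL_apply, ← M.integral_damaged_elastic u u z
    (U.grad_lower e.two_le_pTilde u) (U.grad_lower e.two_le_pTilde u)]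
  rfl

theorem duE_lower (t : ℝ) (u v : U G e.pTilde) (z : Z G) :
    M.duE t u z (v.lower e.two_le_pTilde)
      = M.elasticForm (mulGrad G e z u) (mulGrad G e z v)
        + M.η * M.elasticForm (gradL e.two_le_pTilde u) (gradL e.two_le_pTilde v)
        - M.ℓ t (loadL G e v) := by
  rw [duE, loadL_apply, ← M.integral_damaged_elastic u v z Filter.EventuallyEq.rfl
    (U.grad_lower e.two_le_pTilde v)]
  rfl

end Model

end ElasticForm

/-! ### The derivative of the energy and the slope -/

section Slope

variable {G : Geometry} {e : Exponents}

/-- An element of `Z` carries its gradient as a second component, which must also vanish: this is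
the fundamental lemma of the calculus of variations on the open set `Ω`. -/
theorem Z.eq_zero_of_fn_ae_eq_zero {v : Z G} (hv : v.fn =ᵐ[G.μ] 0) : v = 0 := by
  have hfst : v.1.fst = 0 := Lp.ext (hv.trans (Lp.coeFn_zero _ _ _).symm)
  have hi (i : Fin 2) : ∀ᵐ x ∂G.μ, v.1.snd x i = 0 := by
    have h1 : ∀ᵐ x ∂G.μ, x ∈ G.Ω → v.1.snd x i = 0 := by
      refine G.isOpen.ae_eq_zero_of_integral_contDiff_smul_eq_zero
        ((integrable_snd v.1 i).locallyIntegrable.locallyIntegrableOn _) fun φ hφ hc hs => ?_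
      have h2 : (∫ x, partialDeriv i φ x • v.1.fst x ∂G.μ) + ∫ x, φ x • v.1.snd x i ∂G.μ = 0 :=
        v.2 i φ ⟨hφ, hc⟩ hs
      have h3 : ∫ x, partialDeriv i φ x • v.1.fst x ∂G.μ = 0 := by
        refine integral_eq_zero_of_ae ?_
        filter_upwards [hv] with x hx
        have : v.1.fst x = 0 := hx
        simp [this]
      rwa [h3, zero_add] at h2
    filter_upwards [h1, ae_restrict_mem G.isOpen.measurableSet] with x hx hxΩ using hx hxΩ
  have hsnd : v.1.snd = 0 := by
    refine Lp.ext ?_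
    filter_upwards [hi 0, hi 1, Lp.coeFn_zero (GradVal ℝ) 2 G.μ] with x h0 h1 hz
    rw [hz]
    ext i
    fin_cases i
    · exact h0
    · exact h1
  refine Subtype.ext ?_
  rw [← WithLp.toLp_ofLp 2 v.1]
  exact congrArg (WithLp.toLp 2) (Prod.ext hfst hsnd)

theorem Z.eq_zero_of_normV_eq_zero {v : Z G} (hv : normV e v = 0) : v = 0 := by
  refine Z.eq_zero_of_fn_ae_eq_zero ((eLpNorm_eq_zero_iff (Lp.aestronglyMeasurable v.1.fst) ?_).1 hv)
  exact (lt_of_lt_of_le one_pos (Fact.out : 1 ≤ e.alpha)).ne'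

namespace Model

variable (M : Model G e)

theorem hasFDerivAt_energyT (t : ℝ) (u : U G e.pTilde) (z : Z G) :
    HasFDerivAt (fun ζ => M.energyT t u ζ)
      (M.κ • innerSL ℝ z
        + (M.elasticForm (mulGrad G e z u)) ∘L (mulGrad G e).flip u) z := by
  set A : Z G →L[ℝ] Lp (GradVal E2) 2 G.μ := (mulGrad G e).flip u with hA
  have h1 : HasFDerivAt (fun ζ : Z G => ‖ζ‖ ^ 2) (2 • innerSL ℝ z) z :=
    (hasStrictFDerivAt_norm_sq z).hasFDerivAt
  have h2 : HasFDerivAt (fun ζ : Z G => M.elasticForm (A ζ) (A ζ))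
      (M.elasticForm.precompR _ (A z) A + M.elasticForm.precompL _ A (A z)) z :=
    M.elasticForm.hasFDerivAt_of_bilinear A.hasFDerivAt A.hasFDerivAt
  have h3 := (((h1.const_mul (M.κ / 2)).add
    ((h2.add_const (M.η * M.elasticForm (gradL e.two_le_pTilde u)
      (gradL e.two_le_pTilde u))).const_mul (1 / 2))).sub_const (M.ℓ t (loadL G e u)))
  have h4 : (fun ζ => M.energyT t u ζ) = fun ζ => M.κ / 2 * ‖ζ‖ ^ 2
      + 1 / 2 * (M.elasticForm (A ζ) (A ζ) + M.η * M.elasticForm (gradL e.two_le_pTilde u)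
      (gradL e.two_le_pTilde u)) - M.ℓ t (loadL G e u) := funext fun ζ => M.energyT_eq t u ζ
  rw [h4]
  refine h3.congr_fderiv (ContinuousLinearMap.ext fun v => ?_)
  -- Symmetry merges the two product-rule terms and cancels the factor `1/2`.
  have h5 := M.elasticForm_symm (A v) (A z)
  simp only [add_apply, smul_apply, smul_eq_mul, ContinuousLinearMap.precompR_apply,
    ContinuousLinearMap.precompL_apply, ContinuousLinearMap.compL_apply, ContinuousLinearMap.comp_apply,
    nsmul_eq_mul, h5]
  change _ = M.κ * _ + M.elasticForm (A z) (A v)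
  push_cast
  ring

theorem dzE_apply (t : ℝ) (u : U G e.pTilde) (z v : Z G) :
    M.dzE t u z v = M.κ * inner ℝ z v
      + M.elasticForm (mulGrad G e z u) (mulGrad G e v u) := by
  rw [dzE, (M.hasFDerivAt_energyT t u z).fderiv]
  rfl

/-- The subgradient inequality at `0`, where `R(0) ≥ 0` may be dropped. -/
theorem ofReal_apply_le_dissipation {σ : StrongDual ℝ (Z G)} (hσ : σ ∈ M.stableSet) (v : Z G) :
    ENNReal.ofReal (σ v) ≤ M.dissipation v.fn := by
  have h1 : (M.dissipation (0 : Z G).fn : EReal) + ((σ (v - 0) : ℝ) : EReal)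
      ≤ (M.dissipation v.fn : EReal) := hσ v
  rw [sub_zero] at h1
  rw [← EReal.coe_ennreal_le_coe_ennreal_iff, EReal.coe_ennreal_ofReal]
  rcases le_total (σ v) 0 with h | h
  · rw [max_eq_right h]
    exact EReal.coe_ennreal_nonneg _
  · rw [max_eq_left h]
    exact (le_add_of_nonneg_left (EReal.coe_ennreal_nonneg _)).trans h1

/-- Each splitting `-D_z E = σ + θ` with `σ ∈ ∂R(0)` and `θ ∈ V*` yields the bound with `‖θ‖` in
place of the slope; the infimum over splittings gives the claim. If there is no splitting, the right
side is infinite unless `v = 0`. -/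
theorem ofReal_neg_dzE_le (t : ℝ) (u : U G e.pTilde) (z v : Z G) (hv : normV e v ≠ ⊤) :
    ENNReal.ofReal (-(M.dzE t u z v))
      ≤ M.dissipation v.fn + normV e v * M.slope t u z := by
  -- With `0 * ∞ = 0` an infinite slope gives no help here, so the case needs `v = 0` itself.
  by_cases hv0 : normV e v = 0
  · rw [Z.eq_zero_of_normV_eq_zero hv0, map_zero, neg_zero, ENNReal.ofReal_zero]
    exact zero_le
  have hmem : MemLp v.fn e.alpha G.μ := ⟨Lp.aestronglyMeasurable v.1.fst, hv.lt_top⟩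
  -- Solving for the slope first lets the infimum be treated one competitor at a time.
  have key : (ENNReal.ofReal (-(M.dzE t u z v)) - M.dissipation v.fn) / normV e v
      ≤ M.slope t u z := by
    refine le_iInf fun σ => le_iInf fun hσ => le_iInf fun θ => le_iInf fun hθ => ?_
    refine ENNReal.div_le_of_le_mul (tsub_le_iff_left.2 ?_)
    have h1 : (-M.dzE t u z - σ) v = θ (hmem.toLp _) := hθ v _ hmem.coeFn_toLp.symm
    have h2 : -(M.dzE t u z v) = σ v + θ (hmem.toLp _) := by
      rw [← h1, sub_apply, neg_apply]
      ring
    rw [h2]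
    refine ENNReal.ofReal_add_le.trans (add_le_add (M.ofReal_apply_le_dissipation hσ v) ?_)
    calc ENNReal.ofReal (θ (hmem.toLp _)) ≤ ENNReal.ofReal (‖θ‖ * (normV e v).toReal) := by
          refine ENNReal.ofReal_le_ofReal ((le_abs_self _).trans ((θ.le_opNorm _).trans_eq ?_))
          rw [Lp.norm_toLp]
          rfl
      _ = _ := by rw [ENNReal.ofReal_mul (norm_nonneg _), ENNReal.ofReal_toReal hv]
  rw [ENNReal.div_le_iff hv0 hv, tsub_le_iff_left, mul_comm] at key
  exact key

end Model

end Slope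

/-! ### The chain rule along parameterized curves -/

section ChainRule

variable {G : Geometry} {e : Exponents}

theorem _root_.ContinuousLinearMap.hasDerivAt_bilin {Y W H : Type*} [NormedAddCommGroup Y]
    [NormedSpace ℝ Y] [NormedAddCommGroup W] [NormedSpace ℝ W] [NormedAddCommGroup H]
    [NormedSpace ℝ H] (B : Y →L[ℝ] W →L[ℝ] H) {f : ℝ → Y} {g : ℝ → W} {f' : Y} {g' : W} {s : ℝ}
    (hf : HasDerivAt f f' s) (hg : HasDerivAt g g' s) :
    HasDerivAt (fun s => B (f s) (g s)) (B f' (g s) + B (f s) g') s :=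
  (B.hasFDerivAt.comp_hasDerivAt s hf).clm_apply hg

/-- Only the negative part of `f` has to be dominated. `F` need not be measurable, since the lower
integral is monotone in any case; the measurability of the slope along the curve is thereby avoided.
-/
theorem intervalIntegral_neg_le_lintegral {f : ℝ → ℝ} {F : ℝ → ℝ≥0∞} {a b : ℝ} (hab : a ≤ b)
    (hf : IntervalIntegrable f volume a b)
    (hF : ∀ᵐ s ∂volume.restrict (Icc a b), ENNReal.ofReal (-f s) ≤ F s)
    (hfin : ∫⁻ s in Icc a b, F s ≠ ⊤) :
    -∫ s in a..b, f s ≤ (∫⁻ s in Icc a b, F s).toReal := by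
  have hneg : Integrable (fun s => -f s) (volume.restrict (Icc a b)) :=
    ((intervalIntegrable_iff_integrableOn_Icc_of_le hab).1 hf).neg
  rw [intervalIntegral.integral_of_le hab, ← integral_Icc_eq_integral_Ioc, ← integral_neg,
    integral_eq_lintegral_pos_part_sub_lintegral_neg_part hneg]
  refine (sub_le_self _ ENNReal.toReal_nonneg).trans (ENNReal.toReal_mono hfin ?_)
  exact lintegral_mono_ae hF

/-! The energy has the form `κ/2 ‖z‖² + (b(P(z,u), P(z,u)) + η b(Du, Du))/2 - f(Λu)` with bounded
bilinear maps `b` and `P`; the calculus is carried out for arbitrary spaces. -/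

section QuadraticEnergy

variable {X Y B W : Type*} [NormedAddCommGroup X] [InnerProductSpace ℝ X]
  [NormedAddCommGroup Y] [NormedSpace ℝ Y] [NormedAddCommGroup B] [NormedSpace ℝ B]
  [NormedAddCommGroup W] [NormedSpace ℝ W]

/-- The energy `κ/2 ‖z‖² + (b(P(z,u), P(z,u)) + η b(Du, Du))/2 - f(Λu)`. -/
def quadraticEnergy (κ η : ℝ) (b : W →L[ℝ] W →L[ℝ] ℝ) (P : X →L[ℝ] Y →L[ℝ] W) (D : Y →L[ℝ] W)
    (Λ : Y →L[ℝ] B) (f : StrongDual ℝ B) (u : Y) (z : X) : ℝ :=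
  κ / 2 * ‖z‖ ^ 2 + 1 / 2 * (b (P z u) (P z u) + η * b (D u) (D u)) - f (Λ u)

variable (κ η : ℝ) (b : W →L[ℝ] W →L[ℝ] ℝ) (P : X →L[ℝ] Y →L[ℝ] W) (D : Y →L[ℝ] W)
  (Λ : Y →L[ℝ] B)

theorem absolutelyContinuous_quadraticEnergy {a c : ℝ} {f : ℝ → StrongDual ℝ B} {u : ℝ → Y}
    {z : ℝ → X} (hf : AbsolutelyContinuousOnInterval f a c)
    (hu : AbsolutelyContinuousOnInterval u a c) (hz : AbsolutelyContinuousOnInterval z a c) :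
    AbsolutelyContinuousOnInterval
      (fun s => quadraticEnergy κ η b P D Λ (f s) (u s) (z s)) a c := by
  have hw := hz.bilin P hu
  let I : X →L[ℝ] X →L[ℝ] ℝ := innerSL ℝ
  have hI (x : X) : I x x = ‖x‖ ^ 2 := real_inner_self_eq_norm_sq x
  have h1 := (hz.bilin I hz).const_mul (κ / 2)
  have h2 := hw.bilin b hw
  have h3 := (hu.bilin (b.bilinearComp D D) hu).const_mul η
  have h4 := hf.bilin ((ContinuousLinearMap.compL ℝ Y B ℝ).flip Λ) hu
  have h5 := (h1.add ((h2.add h3).const_mul (1 / 2))).sub h4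
  refine h5.of_dist_le (C := 1) fun x _ y _ => ?_
  rw [one_mul]
  refine le_of_eq ?_
  congr 1 <;> simp [quadraticEnergy, hI]

theorem hasDerivAt_quadraticEnergy (hb : ∀ v w, b v w = b w v) {f : ℝ → StrongDual ℝ B}
    {u : ℝ → Y} {z : ℝ → X} {f' : StrongDual ℝ B} {u' : Y} {z' : X} {s : ℝ}
    (hf : HasDerivAt f f' s) (hu : HasDerivAt u u' s) (hz : HasDerivAt z z' s) :
    HasDerivAt (fun s => quadraticEnergy κ η b P D Λ (f s) (u s) (z s))
      ((κ * inner ℝ (z s) z' + b (P (z s) (u s)) (P z' (u s)))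
        + (b (P (z s) (u s)) (P (z s) u') + η * b (D (u s)) (D u') - f s (Λ u'))
        - f' (Λ (u s))) s := by
  have hw := P.hasDerivAt_bilin hz hu
  let I : X →L[ℝ] X →L[ℝ] ℝ := innerSL ℝ
  have hI (x y : X) : I x y = inner ℝ x y := rfl
  have h1 := (I.hasDerivAt_bilin hz hz).const_mul (κ / 2)
  have h2 := b.hasDerivAt_bilin hw hw
  have h3 := ((b.bilinearComp D D).hasDerivAt_bilin hu hu).const_mul η
  have hΛ : HasDerivAt (fun s => Λ (u s)) (Λ u') s := Λ.hasFDerivAt.comp_hasDerivAt s hu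
  have h4 := hf.clm_apply hΛ
  have h5 := (h1.add ((h2.add h3).const_mul (1 / 2))).sub h4
  refine (h5.congr_deriv ?_).congr_of_eventuallyEq (Filter.Eventually.of_forall fun s => ?_)
  · have s1 := hb (P z' (u s)) (P (z s) (u s))
    have s2 := hb (P (z s) u') (P (z s) (u s))
    have s3 := hb (D u') (D (u s))
    have s4 := real_inner_comm (z s) z'
    simp only [map_add, add_apply, ContinuousLinearMap.bilinearComp_apply, hI,
      s1, s2, s3, s4]
    ring
  · simp only [quadraticEnergy, Pi.sub_apply, Pi.add_apply,
      ContinuousLinearMap.bilinearComp_apply, hI, real_inner_self_eq_norm_sq]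

end QuadraticEnergy

/-! Functions with values in a dual space, composed with a reparameterization. -/

section Dual

variable {Y B : Type*} [NormedAddCommGroup Y] [NormedSpace ℝ Y] [NormedAddCommGroup B]
  [NormedSpace ℝ B] {f f' : ℝ → StrongDual ℝ B} {t : ℝ → ℝ} {a b c d : ℝ}

/-- A Lipschitz derivative is bounded on the compact interval, so `f` is Lipschitz there by the mean
value inequality. -/
theorem absolutelyContinuous_dual_comp {K : ℝ≥0}
    (hf : ∀ x ∈ Icc c d, HasDerivWithinAt f (f' x) (Icc c d) x)
    (hK : LipschitzOnWith K f' (Icc c d)) (ht : AbsolutelyContinuousOnInterval t a b)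
    (hmaps : MapsTo t (uIcc a b) (Icc c d)) :
    AbsolutelyContinuousOnInterval (fun s => f (t s)) a b := by
  obtain ⟨C, hC⟩ := isCompact_Icc.exists_bound_of_continuousOn hK.continuousOn
  refine ht.of_dist_le (C := C) fun x hx y hy => ?_
  rw [dist_eq_norm, dist_eq_norm]
  exact (convex_Icc c d).norm_image_sub_le_of_norm_hasDerivWithin_le hf hC (hmaps hy) (hmaps hx)

/-- A one-sided derivative of `f` at an endpoint of `[c, d]` suffices, because `t` never leaves `[c,
d]` near `s`. -/
theorem hasDerivAt_dual_comp {t' s : ℝ} (hf : HasDerivWithinAt f (f' (t s)) (Icc c d) (t s))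
    (ht : HasDerivAt t t' s) (hs : s ∈ Ioo a b) (hmaps : MapsTo t (Icc a b) (Icc c d)) :
    HasDerivAt (fun s => f (t s)) (t' • f' (t s)) s :=
  (hf.scomp s ht.hasDerivWithinAt hmaps).hasDerivAt (Icc_mem_nhds hs.1 hs.2)

theorem continuousOn_dual_apply_comp (Λ : Y →L[ℝ] B) {u : ℝ → Y} {K : ℝ≥0} {I J : Set ℝ}
    (hf : LipschitzOnWith K f J) (ht : ContinuousOn t I) (hmaps : MapsTo t I J)
    (hu : ContinuousOn u I) : ContinuousOn (fun s => f (t s) (Λ (u s))) I :=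
  (hf.continuousOn.comp ht hmaps).clm_apply (Λ.continuous.comp_continuousOn hu)

end Dual

/-! ### The lower energy-dissipation estimate -/

namespace Model

variable (M : Model G e)

/-- `t` is absolutely continuous with `t' ≥ 0` a.e., hence monotone between its end values `0` and
`T`. The load is controlled on `[0, T]` only. -/
theorem time_mem_Icc {S : ℝ} {t : ℝ → ℝ} {u : ℝ → U G e.pTilde} {z : ℝ → Z G}
    (ht : AbsolutelyContinuousOnInterval t 0 S) (ht0 : t 0 = 0) (htS : t S = M.T)
    (hcompl : M.Complementarity S t u z) {s : ℝ} (hs : s ∈ Icc 0 S) : t s ∈ Icc 0 M.T := by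
  have hmono {a b : ℝ} (ha : a ∈ Icc 0 S) (hb : b ∈ Icc 0 S) (hab : a ≤ b) : t a ≤ t b := by
    have hsub : uIcc a b ⊆ uIcc 0 S := by
      rw [uIcc_of_le hab, uIcc_of_le (hs.1.trans hs.2)]
      exact Icc_subset_Icc ha.1 hb.2
    rw [← sub_nonneg, ← (ht.mono hsub).integral_deriv_eq_sub]
    refine intervalIntegral.integral_nonneg_of_ae_restrict hab ?_
    refine ae_restrict_of_ae_restrict_of_subset (Icc_subset_Icc ha.1 hb.2) ?_
    filter_upwards [hcompl] with r hr using hr.1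
  have h0 := hmono ⟨le_rfl, hs.1.trans hs.2⟩ hs hs.1
  have hS := hmono hs ⟨hs.1.trans hs.2, le_rfl⟩ hs.2
  rw [ht0] at h0
  rw [htS] at hS
  exact ⟨h0, hS⟩

theorem dtE_eq {ℓ' : StrongDual ℝ (U G e.pConj)} {t : ℝ} (ht : t ∈ Icc 0 M.T)
    (hℓ : HasDerivWithinAt M.ℓ ℓ' (Icc 0 M.T) t) (u : U G e.pTilde) (z : Z G) :
    M.dtE t u z = -ℓ' (loadL G e u) := by
  have h1 : HasDerivWithinAt (fun τ => M.energyT τ u z) (-ℓ' (loadL G e u)) (Icc 0 M.T) t := by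
    simp only [M.energyT_eq]
    refine HasDerivWithinAt.const_sub _ ?_
    have := hℓ.clm_apply (hasDerivWithinAt_const t (Icc 0 M.T) (loadL G e u))
    simpa using this
  exact h1.derivWithin (uniqueDiffOn_Icc M.T_pos t ht)

theorem energyT_eq_quadraticEnergy (t : ℝ) (u : U G e.pTilde) (z : Z G) :
    M.energyT t u z = quadraticEnergy M.κ M.η M.elasticForm (mulGrad G e)
      (gradL e.two_le_pTilde) (loadL G e) (M.ℓ t) u z :=
  M.energyT_eq t u z

theorem hasDerivAt_energy {t : ℝ → ℝ} {u : ℝ → U G e.pTilde} {z : ℝ → Z G}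
    {ℓ' : StrongDual ℝ (U G e.pConj)} {t' : ℝ} {u' : U G e.pTilde} {z' : Z G} {s : ℝ}
    (hℓ : HasDerivAt (fun s => M.ℓ (t s)) (t' • ℓ') s) (hu : HasDerivAt u u' s)
    (hz : HasDerivAt z z' s) :
    HasDerivAt (fun s => M.energyT (t s) (u s) (z s))
      (M.dzE (t s) (u s) (z s) z' + M.duE (t s) (u s) (z s) (u'.lower e.two_le_pTilde)
        - t' * ℓ' (loadL G e (u s))) s := by
  rw [dzE_apply, duE_lower]
  simp only [M.energyT_eq_quadraticEnergy]
  have h := hasDerivAt_quadraticEnergy (f := fun s => M.ℓ (t s)) (f' := t' • ℓ') (u := u)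
    (z := z) (u' := u') (z' := z') (s := s) M.κ M.η M.elasticForm (mulGrad G e)
    (gradL e.two_le_pTilde) (loadL G e) M.elasticForm_symm hℓ hu hz
  refine h.congr_deriv ?_
  congr 1

/-- Integrating the chain rule and estimating `-⟨D_z E, z'⟩` pointwise by the dissipation integrand;
this is the half of the balance that costs no energy assumption. -/
theorem initialPlusWork_le_storedPlusDissipated {S : ℝ} (hS : 0 < S) {t : ℝ → ℝ}
    {u : ℝ → U G e.pTilde} {z : ℝ → Z G} (hreg : IsAdmissible S t u z) (ht0 : t 0 = 0)
    (htS : t S = M.T) (hcompl : M.Complementarity S t u z) (hmom : M.MomentumBalance S t u z)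
    {s₁ : ℝ} (hs₁ : s₁ ∈ Icc 0 S) :
    (M.initialPlusWork t u z s₁ : EReal) ≤ M.storedPlusDissipated t u z s₁ := by
  obtain ⟨ℓ', K, hℓ', hK⟩ := M.ℓ_reg
  have ht := hreg.t_mem.absolutelyContinuousOnInterval le_top hS
  have hu := hreg.u_mem.absolutelyContinuousOnInterval le_top hS
  have hz := hreg.z_memZ.absolutelyContinuousOnInterval one_le_two hS
  have htI {s : ℝ} (hs : s ∈ Icc 0 S) : t s ∈ Icc 0 M.T := M.time_mem_Icc ht ht0 htS hcompl hs
  have hIcc : uIcc 0 S = Icc 0 S := uIcc_of_le hS.le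
  have hℓt : AbsolutelyContinuousOnInterval (fun s => M.ℓ (t s)) 0 S :=
    absolutelyContinuous_dual_comp hℓ' hK ht fun s hs => htI (by rwa [hIcc] at hs)
  set E : ℝ → ℝ := fun s => M.energyT (t s) (u s) (z s) with hEdef
  have hE : AbsolutelyContinuousOnInterval E 0 S := by
    simp only [hEdef, M.energyT_eq_quadraticEnergy]
    exact absolutelyContinuous_quadraticEnergy M.κ M.η M.elasticForm (mulGrad G e)
      (gradL e.two_le_pTilde) (loadL G e) hℓt hu hz
  have hsub : uIcc 0 s₁ ⊆ uIcc 0 S := by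
    rw [hIcc, uIcc_of_le hs₁.1]
    exact Icc_subset_Icc le_rfl hs₁.2
  have hE₁ := hE.mono hsub
  set W : ℝ → ℝ := fun s => M.dtE (t s) (u s) (z s) * deriv t s with hW
  -- Along the curve `∂ₜE = -⟨ℓ'(t), u⟩` is continuous, and `t'` is integrable.
  have hWint : IntervalIntegrable W volume 0 s₁ := by
    have hcont : ContinuousOn (fun s => -ℓ' (t s) (loadL G e (u s))) (Icc 0 S) :=
      (continuousOn_dual_apply_comp (loadL G e) hK hreg.t_mem.1 (fun s hs => htI hs)
        hreg.u_mem.1).neg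
    refine ((ht.mono hsub).intervalIntegrable_deriv.continuousOn_mul
      (hcont.mono (by rw [← hIcc]; exact hsub))).congr fun s hs => ?_
    have hsI : s ∈ Icc 0 S := by
      rw [← hIcc]
      exact hsub (uIoc_subset_uIcc hs)
    simp only [hW]
    rw [M.dtE_eq (htI hsI) (hℓ' _ (htI hsI))]
  have hae : ∀ᵐ s ∂volume.restrict (Icc 0 S),
      deriv E s = M.dzE (t s) (u s) (z s) (deriv z s) + W s ∧
        ENNReal.ofReal (-(M.dzE (t s) (u s) (z s) (deriv z s))) ≤
          M.dissipation (deriv z s).fn + normV e (deriv z s) * M.slope (t s) (u s) (z s) := by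
    have hne (c : ℝ) : ∀ᵐ s ∂volume.restrict (Icc 0 S), s ≠ c :=
      ae_restrict_of_ae (by simp [ae_iff, measure_singleton])
    filter_upwards [hreg.t_mem.ae_differentiableAt le_top hS,
      hreg.u_mem.ae_differentiableAt le_top hS, hreg.z_memZ.ae_differentiableAt one_le_two hS,
      hcompl, hmom, hne 0, hne S, ae_restrict_mem measurableSet_Icc]
      with s hts hus hzs hcs hms hs0 hsS hsI
    constructor
    · have hℓs : HasDerivAt (fun s => M.ℓ (t s)) (deriv t s • ℓ' (t s)) s :=
        hasDerivAt_dual_comp (hℓ' _ (htI hsI)) hts.hasDerivAt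
          ⟨lt_of_le_of_ne hsI.1 hs0.symm, lt_of_le_of_ne hsI.2 hsS⟩ fun r hr => htI hr
      -- `hms` is the momentum balance tested with `u'`, which lies in `U^{p̃} ⊆ U`.
      rw [hEdef, (M.hasDerivAt_energy hℓs hus.hasDerivAt hzs.hasDerivAt).deriv, hms]
      simp only [hW]
      rw [M.dtE_eq (htI hsI) (hℓ' _ (htI hsI))]
      ring
    · refine M.ofReal_neg_dzE_le _ _ _ _ ?_
      -- Complementarity bounds `‖z'‖_V` by `1`, in particular it is finite.
      exact ((le_add_self.trans hcs.2.1).trans_lt ENNReal.one_lt_top).ne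
  have hae₁ := ae_restrict_of_ae_restrict_of_subset (Icc_subset_Icc (le_refl (0 : ℝ)) hs₁.2) hae
  rw [storedPlusDissipated, initialPlusWork]
  set J : ℝ≥0∞ := ∫⁻ s in Icc 0 s₁, (M.dissipation (deriv z s).fn
      + normV e (deriv z s) * M.slope (t s) (u s) (z s)) with hJ
  -- Infinite dissipation makes the claim trivial; otherwise everything is real.
  by_cases hJtop : J = ⊤
  · rw [hJtop, EReal.coe_ennreal_top, EReal.coe_add_top]
    exact le_top
  have hdiff : IntervalIntegrable (fun s => deriv E s - W s) volume 0 s₁ :=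
    hE₁.intervalIntegrable_deriv.sub hWint
  have hle := intervalIntegral_neg_le_lintegral hs₁.1 hdiff (F := fun s =>
    M.dissipation (deriv z s).fn + normV e (deriv z s) * M.slope (t s) (u s) (z s)) (by
      filter_upwards [hae₁] with s hs
      rw [hs.1, add_sub_cancel_right]
      exact hs.2) hJtop
  rw [intervalIntegral.integral_sub hE₁.intervalIntegrable_deriv hWint,
    hE₁.integral_deriv_eq_sub] at hle
  have hJ' : (J : EReal) = ((J.toReal : ℝ) : EReal) := (EReal.coe_ennreal_toReal hJtop).symm
  rw [hJ', ← EReal.coe_add, EReal.coe_le_coe_iff]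
  change E 0 + ∫ s in (0 : ℝ)..s₁, W s ≤ E s₁ + J.toReal
  linarith

end Model

end ChainRule

end DamageModel

end

theorem lemma3p13 (G : DamageModel.Geometry) (e : DamageModel.Exponents)
    (M : DamageModel.Model G e)
    (z₀ : DamageModel.Z G) (hz₀ : ∀ᵐ x ∂G.μ, z₀.fn x ∈ Set.Icc (0 : ℝ) 1)
    (S : ℝ) (hS : 0 < S)
    (t : ℝ → ℝ) (u : ℝ → DamageModel.U G e.pTilde) (z : ℝ → DamageModel.Z G)
    (hreg : DamageModel.IsAdmissible S t u z)
    (hinit : M.InitialConditions z₀ S t u z)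
    (hcompl : M.Complementarity S t u z)
    (hmom : M.MomentumBalance S t u z) :
    M.IsBVSolution S t u z ↔ M.EnergyInequality S t u z :=
  ⟨fun h s₁ hs₁ => (h.energy_balance s₁ hs₁).le, fun h =>
    ⟨hreg, hcompl, hmom, fun s₁ hs₁ => le_antisymm (h s₁ hs₁)
      (M.initialPlusWork_le_storedPlusDissipated hS hreg hinit.t_zero hinit.t_end hcompl hmom
        hs₁)⟩⟩
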